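/- Let $d\ge 1$ be an integer, write points of $\mathbb R^{1+2d}$ as $(t,x,v)$ with $t\in\mathbb R$, $x,v\in\mathbb R^d$, and let $$p\in\Bigl(2-\frac{2}{3d+2},\,2+\frac2d\Bigr),\qquad p'=\frac{p}{p-1},\qquad \bar q=p\,\frac{4d+2}{d(p+2)}.$$ For $q\in(\max\{p,p'\},\bar q)$ set $$s(q)=\frac{p(4d+2)-qd(p+2)}{q\,[d(p-2)+2p+2]},\qquad \alpha(q)=\frac{3d+1}{4d+2}-\frac{d-1}{4d+2}\,s(q).$$ Then $0<s(q)<\frac13$, $$\alpha(q)=\frac{q\,[p(1+d)-d+1]-(d-1)p}{q\,[d(p-2)+2p+2]},$$ and there exists a constant $C=C(d,p,q)>0$ such that the following holds. If $f\in L^2(\mathbb R^{1+2d})$ is real-valued, its distributional gradient $\nabla_v f$ belongs to $L^p(\mathbb R^{1+2d};\mathbb R^d)$, and $$(\partial_t+v\cdot\nabla_x)f=\nabla_v\cdot S_0$$ in the sense of distributions on $\mathbb R^{1+2d}$ for some $S_0\in L^{p'}(\mathbb R^{1+2d};\mathbb R^d)$, then $$\sup_{h\in\mathbb R^d\setminus\{0\}}\frac{\|\Delta_x^h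 f\|_{L^q(\mathbb R^{1+2d})}}{|h|^{s(q)}}\le C\,\|\nabla_v f\|_{L^p(\mathbb R^{1+2d})}^{\alpha(q)}\,\|S_0\|_{L^{p'}(\mathbb R^{1+2d})}^{1-\alpha(q)},$$ where $[\Delta_x^h f](t,x,v)=f(t,x+h,v)-f(t,x,v)$. -/

import Mathlib

open MeasureTheory
open scoped ENNReal ContDiff

namespace Kinetic

/-- Euclidean `ℝ^d`, in which the position `x` and the velocity `v` live. -/
abbrev Sp (d : ℕ) : Type := EuclideanSpace ℝ (Fin d)

/-- The phase space `ℝ^{1+2d}` of points `z = (t, x, v)`, with Lebesgue measure `volume`. -/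
abbrev Phase (d : ℕ) : Type := ℝ × Sp d × Sp d

/-- Test functions: `C_c^∞(ℝ^{1+2d})`. -/
def IsTest {d : ℕ} (φ : Phase d → ℝ) : Prop :=
  ContDiff ℝ ∞ φ ∧ HasCompactSupport φ

/-- The classical velocity gradient `∇_v φ`, with components `∂_{v_i} φ`. -/
noncomputable def gradV {d : ℕ} (φ : Phase d → ℝ) (z : Phase d) : Sp d :=
  WithLp.toLp 2 fun i => fderiv ℝ φ z (0, 0, EuclideanSpace.single i 1)

/-- The classical transport derivative `(∂_t + v · ∇_x) φ` at `z = (t, x, v)`: the derivative of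
`φ` in the direction `(1, v, 0)`. -/
noncomputable def transport {d : ℕ} (φ : Phase d → ℝ) (z : Phase d) : ℝ :=
  fderiv ℝ φ z (1, z.2.2, 0)

/-- `∇_v f = G` in the sense of distributions on `ℝ^{1+2d}` (for locally integrable `f`, `G`). -/
def IsWeakGradV {d : ℕ} (f : Phase d → ℝ) (G : Phase d → Sp d) : Prop :=
  ∀ φ : Phase d → ℝ, IsTest φ → ∀ i : Fin d,
    ∫ z, f z * gradV φ z i = -∫ z, G z i * φ z

/-- `(∂_t + v · ∇_x) f = ∇_v · S` in the sense of distributions on `ℝ^{1+2d}`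
(for locally integrable `f`, `S`); the formal adjoint of `∂_t + v · ∇_x` is its negative. -/
def TransportEqDivV {d : ℕ} (f : Phase d → ℝ) (S : Phase d → Sp d) : Prop :=
  ∀ φ : Phase d → ℝ, IsTest φ →
    -∫ z, f z * transport φ z = -∫ z, inner ℝ (S z) (gradV φ z)

/-- The finite difference `[Δ_x^h f](t, x, v) = f(t, x + h, v) - f(t, x, v)`. -/
def diffX {d : ℕ} (h : Sp d) (f : Phase d → ℝ) (z : Phase d) : ℝ :=
  f (z.1, z.2.1 + h, z.2.2) - f z

/-- The homogeneous Besov norm `sup_{h ≠ 0} ‖Δ_x^h f‖_{L^q} / |h|^s` in the `x`-variable,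
with values in `[0, ∞]`. -/
noncomputable def besovX {d : ℕ} (s : ℝ) (q : ℝ≥0∞) (f : Phase d → ℝ) : ℝ≥0∞ :=
  ⨆ (h : Sp d) (_ : h ≠ 0), eLpNorm (diffX h f) q volume / ENNReal.ofReal (‖h‖ ^ s)

end Kinetic

/-!
The proof compares `f` with its mollifications along the Galilean group
`(t, x, v) ∘ (t', x', v') = (t + t', x + x' + t' v, v + v')`. Its left-invariant fields are `∂_v`,
`∂_t + v · ∇_x` and their commutator `∂_x`. Mollifying at time scale `T`, velocity scale `V` and
position scale `T V` means integrating `w ↦ f (kinMap z T V w)` against a fixed bump function, and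
`f ∘ kinMap z T V` solves the same equations with `∇_v f` and the source multiplied by `V` and
`T / V`. Every estimate therefore reduces to unit scale at the origin.

At unit scale, `∂_{x_i} = ∂_{v_i} (∂_t + v · ∇_x) - (∂_t + v · ∇_x) ∂_{v_i}` shows that pairing a
weak solution with any first derivative of a test function costs no more than the `L¹` mass of
`∇_v f` and of the source in a ball (`IsTestIn.controlled_derivX`). The same then holds for the
generator of the dilations (`IsTestIn.controlled_euler`), and, by the mean value inequality, for the
change of a mollification under a fixed dilation (`IsTestIn.dil_sub_controlled`) or a unit shift in
`x` (`IsTestIn.shift_sub_controlled`).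

Young's inequality on the group (`mass_young`) turns these pointwise bounds into `L^q` bounds with
constant `V J^{1/q-1/p} ‖∇_v f‖_p + (T/V) J^{1/q-1/p'} ‖S₀‖_{p'}`, where `J = T (T V)^d V^d`. The
group has two independent scales. Along the curve with position scale `T V = y` on which the two
terms balance, their common value is `y^s ‖∇_v f‖_p^α ‖S₀‖_{p'}^{1-α}` (`balanced_scales`). Since
`s > 0`, the differences of consecutive mollifications sum over the scales `y = |h| e^{-n}`, and
the mollification at scale `|h|` absorbs the shift by `h`. The hypothesis `f ∈ L²` serves only to
identify the limit of the mollifications.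
-/

namespace Kinetic

variable {d : ℕ}

/-! ### Galilean translations and kinetic dilations -/

/-- Instance search does not see through `volume = volume.prod volume`. -/
instance : (volume : Measure (Sp d × Sp d)).IsAddHaarMeasure :=
  inferInstanceAs ((volume : Measure (Sp d)).prod volume).IsAddHaarMeasure

instance : (volume : Measure (Phase d)).IsAddHaarMeasure :=
  Measure.prod.instIsAddHaarMeasure (volume : Measure ℝ) (volume : Measure (Sp d × Sp d))

/-- The linear part of `kinMap z T V`: the anisotropic dilation by `(T, T V, V)` followed by the
Galilean shear `(t, x, v) ↦ (t, x + t v₀, v)`, where `v₀` is the velocity of `z`. -/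
noncomputable def kinLin (z : Phase d) (T V : ℝ) : Phase d →L[ℝ] Phase d :=
  (T • ContinuousLinearMap.fst ℝ ℝ (Sp d × Sp d)).prod
    (((T * V) • (ContinuousLinearMap.fst ℝ (Sp d) (Sp d)).comp
          (ContinuousLinearMap.snd ℝ ℝ (Sp d × Sp d)) +
        T • (ContinuousLinearMap.fst ℝ ℝ (Sp d × Sp d)).smulRight z.2.2).prod
      (V • (ContinuousLinearMap.snd ℝ (Sp d) (Sp d)).comp
          (ContinuousLinearMap.snd ℝ ℝ (Sp d × Sp d))))

/-- The map `w ↦ z ∘ δ w`, where `δ` is the kinetic dilation with time scale `T`, velocity scale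
`V` and position scale `T V`, and `∘` is the Galilean group law
`(t, x, v) ∘ (t', x', v') = (t + t', x + x' + t' v, v + v')`. -/
noncomputable def kinMap (z : Phase d) (T V : ℝ) (w : Phase d) : Phase d := z + kinLin z T V w

@[simp] lemma kinLin_apply (z : Phase d) (T V : ℝ) (w : Phase d) :
    kinLin z T V w = (T * w.1, (T * V) • w.2.1 + (T * w.1) • z.2.2, V • w.2.2) := by
  simp [kinLin, smul_smul]

lemma kinMap_apply (z : Phase d) (T V : ℝ) (w : Phase d) :
    kinMap z T V w =
      (z.1 + T * w.1, z.2.1 + (T * V) • w.2.1 + (T * w.1) • z.2.2, z.2.2 + V • w.2.2) := by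
  ext <;> simp [kinMap, add_assoc]

lemma kinMap_zero_apply (T V : ℝ) (w : Phase d) :
    kinMap 0 T V w = (T * w.1, (T * V) • w.2.1, V • w.2.2) := by
  simp [kinMap_apply]

lemma kinMap_comp (z : Phase d) (T V T' V' : ℝ) (w : Phase d) :
    kinMap z T V (kinMap 0 T' V' w) = kinMap z (T * T') (V * V') w := by
  simp only [kinMap_apply, Prod.fst_zero, Prod.snd_zero, smul_zero, add_zero, zero_add, smul_smul,
    mul_assoc, mul_left_comm T' V V']

lemma kinMap_shift (h : Sp d) (w : Phase d) :
    kinMap (0, h, 0) 1 1 w = (w.1, w.2.1 + h, w.2.2) := by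
  simp [kinMap_apply, add_comm]

lemma kinMap_comp_shift (z : Phase d) {T V : ℝ} (h : Sp d) (w : Phase d) :
    kinMap z T V (kinMap (0, h, 0) 1 1 w) =
      kinMap (z.1, z.2.1 + (T * V) • h, z.2.2) T V w := by
  simp only [kinMap_apply, smul_add]
  ext <;> simp; ring

/-- The inverse of `kinMap z T V`. -/
noncomputable def kinInv (z : Phase d) (T V : ℝ) (u : Phase d) : Phase d :=
  (T⁻¹ * (u.1 - z.1), (T * V)⁻¹ • (u.2.1 - z.2.1 - (u.1 - z.1) • z.2.2), V⁻¹ • (u.2.2 - z.2.2))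

lemma contDiff_kinMap (z : Phase d) (T V : ℝ) : ContDiff ℝ ∞ (kinMap z T V) :=
  contDiff_const.add (kinLin z T V).contDiff

lemma contDiff_kinInv (z : Phase d) (T V : ℝ) : ContDiff ℝ ∞ (kinInv z T V) := by
  unfold kinInv
  fun_prop

lemma kinInv_kinMap (z : Phase d) {T V : ℝ} (hT : T ≠ 0) (hV : V ≠ 0) (w : Phase d) :
    kinInv z T V (kinMap z T V w) = w := by
  rw [kinMap_apply]
  refine Prod.ext ?_ (Prod.ext ?_ ?_)
  · simp [kinInv, hT]
  · simp only [kinInv, add_sub_cancel_left, add_assoc]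
    rw [add_sub_cancel_right, smul_smul, inv_mul_cancel₀ (mul_ne_zero hT hV), one_smul]
  · simp [kinInv, smul_smul, hV]

lemma kinMap_kinInv (z : Phase d) {T V : ℝ} (hT : T ≠ 0) (hV : V ≠ 0) (u : Phase d) :
    kinMap z T V (kinInv z T V u) = u := by
  rw [kinMap_apply]
  refine Prod.ext ?_ (Prod.ext ?_ ?_)
  · simp [kinInv, hT]
  · simp only [kinInv]
    rw [smul_smul, mul_inv_cancel₀ (mul_ne_zero hT hV), one_smul, ← mul_assoc, mul_inv_cancel₀ hT,
      one_mul]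
    abel
  · simp [kinInv, smul_smul, hV]

/-- `kinMap z T V` as a homeomorphism of phase space. -/
noncomputable def kinHomeo (z : Phase d) {T V : ℝ} (hT : T ≠ 0) (hV : V ≠ 0) :
    Phase d ≃ₜ Phase d where
  toFun := kinMap z T V
  invFun := kinInv z T V
  left_inv := kinInv_kinMap z hT hV
  right_inv := kinMap_kinInv z hT hV
  continuous_toFun := (contDiff_kinMap z T V).continuous
  continuous_invFun := (contDiff_kinInv z T V).continuous

lemma continuous_kinMap (z : Phase d) (T V : ℝ) : Continuous (kinMap z T V) :=
  (contDiff_kinMap z T V).continuous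

lemma continuous_kinMap_uncurry (T V : ℝ) :
    Continuous fun x : Phase d × Phase d => kinMap x.1 T V x.2 := by
  simp only [kinMap_apply]
  fun_prop

/-- The Jacobian determinant `T (T V)^d V^d` of `kinMap z T V`. -/
noncomputable def jac (d : ℕ) (T V : ℝ) : ℝ := T * (T * V) ^ d * V ^ d

lemma jac_pos {T V : ℝ} (hT : 0 < T) (hV : 0 < V) : 0 < jac d T V := by
  unfold jac; positivity

lemma lintegral_comp_add_smul {E : Type*} [NormedAddCommGroup E] [NormedSpace ℝ E]
    [MeasurableSpace E] [BorelSpace E] [FiniteDimensional ℝ E] (μ : Measure E) [μ.IsAddHaarMeasure]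
    {r : ℝ} (hr : 0 < r) (a : E) (g : E → ℝ≥0∞) :
    ∫⁻ x, g (a + r • x) ∂μ = ENNReal.ofReal ((r ^ Module.finrank ℝ E)⁻¹) * ∫⁻ x, g x ∂μ := by
  have h1 : ∫⁻ x, g (a + r • x) ∂μ = ∫⁻ x, g (a + x) ∂(Measure.map (fun x => r • x) μ) :=
    ((Homeomorph.smulOfNeZero r hr.ne').measurableEmbedding.lintegral_map
      (fun x => g (a + x))).symm
  rw [h1, Measure.map_addHaar_smul μ hr.ne', lintegral_smul_measure, abs_of_pos (by positivity),
    lintegral_add_left_eq_self, smul_eq_mul]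

lemma lintegral_phase {F : Phase d → ℝ≥0∞} (hF : Measurable F) :
    ∫⁻ w, F w = ∫⁻ t : ℝ, ∫⁻ x : Sp d, ∫⁻ v : Sp d, F (t, x, v) := by
  rw [Measure.volume_eq_prod, lintegral_prod _ hF.aemeasurable]
  refine lintegral_congr fun t => ?_
  rw [Measure.volume_eq_prod, lintegral_prod _ (by fun_prop)]

lemma lintegral_phase' {F : Phase d → ℝ≥0∞} (hF : Measurable F) :
    ∫⁻ w, F w = ∫⁻ t : ℝ, ∫⁻ v : Sp d, ∫⁻ x : Sp d, F (t, x, v) := by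
  rw [Measure.volume_eq_prod, lintegral_prod _ hF.aemeasurable]
  refine lintegral_congr fun t => ?_
  rw [Measure.volume_eq_prod, lintegral_prod_symm' _ (by fun_prop)]

lemma map_kinMap (z : Phase d) {T V : ℝ} (hT : 0 < T) (hV : 0 < V) :
    Measure.map (kinMap z T V) volume = ENNReal.ofReal (jac d T V)⁻¹ • volume := by
  refine Measure.ext_of_lintegral _ fun F hF => ?_
  have hm := (continuous_kinMap z T V).measurable
  rw [lintegral_map hF hm, lintegral_smul_measure,
    lintegral_phase (F := fun w => F (kinMap z T V w)) (hF.comp hm)]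
  simp only [kinMap_apply]
  have h1 : ∀ t x, ∫⁻ v : Sp d, F (z.1 + T * t, z.2.1 + (T * V) • x + (T * t) • z.2.2,
      z.2.2 + V • v) = ENNReal.ofReal ((V ^ d)⁻¹) *
        ∫⁻ v : Sp d, F (z.1 + T * t, z.2.1 + (T * t) • z.2.2 + (T * V) • x, v) := fun t x => by
    rw [lintegral_comp_add_smul volume hV z.2.2
      (fun v => F (z.1 + T * t, z.2.1 + (T * V) • x + (T * t) • z.2.2, v))]
    simp [add_right_comm]
  have hG : Measurable fun q : ℝ × Sp d => ∫⁻ v : Sp d, F (q.1, q.2, v) :=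
    Measurable.lintegral_prod_right' (f := fun r : (ℝ × Sp d) × Sp d => F (r.1.1, r.1.2, r.2))
      (by fun_prop)
  have h2 : ∀ t, ∫⁻ x : Sp d, ∫⁻ v : Sp d, F (z.1 + T * t,
      z.2.1 + (T * t) • z.2.2 + (T * V) • x, v) = ENNReal.ofReal (((T * V) ^ d)⁻¹) *
        ∫⁻ x : Sp d, ∫⁻ v : Sp d, F (z.1 + T * t, x, v) := fun t => by
    rw [lintegral_comp_add_smul volume (mul_pos hT hV) (z.2.1 + (T * t) • z.2.2)
      (fun x => ∫⁻ v : Sp d, F (z.1 + T * t, x, v))]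
    simp
  have hH : Measurable fun t : ℝ => ∫⁻ x : Sp d, ∫⁻ v : Sp d, F (t, x, v) :=
    hG.lintegral_prod_right'
  have h3 := lintegral_comp_add_smul (volume : Measure ℝ) hT z.1
    (fun t => ∫⁻ x : Sp d, ∫⁻ v : Sp d, F (t, x, v))
  simp only [smul_eq_mul, Module.finrank_self, pow_one] at h3
  have h4 : ∀ t, ∫⁻ x : Sp d, ENNReal.ofReal ((V ^ d)⁻¹) *
        ∫⁻ v : Sp d, F (z.1 + T * t, z.2.1 + (T * t) • z.2.2 + (T * V) • x, v) =
      ENNReal.ofReal ((V ^ d)⁻¹) * (ENNReal.ofReal (((T * V) ^ d)⁻¹) *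
        ∫⁻ x : Sp d, ∫⁻ v : Sp d, F (z.1 + T * t, x, v)) := fun t => by
    rw [lintegral_const_mul' _ _ ENNReal.ofReal_ne_top, h2]
  simp_rw [h1, h4]
  rw [lintegral_const_mul' _ _ ENNReal.ofReal_ne_top,
    lintegral_const_mul' _ _ ENNReal.ofReal_ne_top, h3, lintegral_phase hF, jac, smul_eq_mul,
    ← mul_assoc, ← mul_assoc, ← ENNReal.ofReal_mul (by positivity),
    ← ENNReal.ofReal_mul (by positivity)]
  congr 2
  rw [mul_inv, mul_inv]; ring

/-- Right translations of the Galilean group preserve Lebesgue measure. -/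
lemma lintegral_kinMap_left {F : Phase d → ℝ≥0∞} (hF : Measurable F) (T V : ℝ) (w : Phase d) :
    ∫⁻ z, F (kinMap z T V w) = ∫⁻ z, F z := by
  have hm : Measurable fun z : Phase d => kinMap z T V w :=
    ((continuous_kinMap_uncurry T V).comp (Continuous.prodMk_left w)).measurable
  rw [lintegral_phase' (F := fun z => F (kinMap z T V w)) (hF.comp hm), lintegral_phase' hF]
  simp only [kinMap_apply, add_assoc]
  have h1 : ∀ t (v : Sp d), ∫⁻ x : Sp d, F (t + T * w.1, x + ((T * V) • w.2.1 + (T * w.1) • v),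
      v + V • w.2.2) = ∫⁻ x : Sp d, F (t + T * w.1, x, v + V • w.2.2) := fun t v =>
    lintegral_add_right_eq_self (fun x => F (t + T * w.1, x, v + V • w.2.2)) _
  have h2 : ∀ t, ∫⁻ v : Sp d, ∫⁻ x : Sp d, F (t + T * w.1, x, v + V • w.2.2) =
      ∫⁻ v : Sp d, ∫⁻ x : Sp d, F (t + T * w.1, x, v) := fun t =>
    lintegral_add_right_eq_self (fun v => ∫⁻ x : Sp d, F (t + T * w.1, x, v)) _
  simp_rw [h1, h2]
  exact lintegral_add_right_eq_self (fun t => ∫⁻ v : Sp d, ∫⁻ x : Sp d, F (t, x, v)) _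

lemma lintegral_kinMap (z : Phase d) {T V : ℝ} (hT : 0 < T) (hV : 0 < V) (F : Phase d → ℝ≥0∞) :
    ∫⁻ w, F (kinMap z T V w) = ENNReal.ofReal (jac d T V)⁻¹ * ∫⁻ w, F w := by
  have := (kinHomeo z hT.ne' hV.ne').measurableEmbedding.lintegral_map (μ := volume) F
  change ∫⁻ a, F a ∂(Measure.map (kinMap z T V) volume) = ∫⁻ w, F (kinMap z T V w) at this
  rw [← this, map_kinMap z hT hV, lintegral_smul_measure, smul_eq_mul]

lemma integral_kinMap (z : Phase d) {T V : ℝ} (hT : 0 < T) (hV : 0 < V) (F : Phase d → ℝ) :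
    ∫ w, F (kinMap z T V w) = (jac d T V)⁻¹ * ∫ w, F w := by
  have := (kinHomeo z hT.ne' hV.ne').measurableEmbedding.integral_map (μ := volume) F
  change ∫ a, F a ∂(Measure.map (kinMap z T V) volume) = ∫ w, F (kinMap z T V w) at this
  rw [← this, map_kinMap z hT hV, integral_smul_measure,
    ENNReal.toReal_ofReal (inv_nonneg.2 (jac_pos hT hV).le), smul_eq_mul]

lemma locallyIntegrable_comp_kinMap {E : Type*} [NormedAddCommGroup E] [NormedSpace ℝ E]
    {f : Phase d → E} (hf : LocallyIntegrable f)
    (z : Phase d) {T V : ℝ} (hT : 0 < T) (hV : 0 < V) :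
    LocallyIntegrable fun w => f (kinMap z T V w) := by
  refine (locallyIntegrable_map_homeomorph (kinHomeo z hT.ne' hV.ne')).1 ?_
  change LocallyIntegrable f (Measure.map (kinMap z T V) volume)
  rw [map_kinMap z hT hV]
  refine fun x => (hf x).imp fun s hs => ⟨hs.1, ?_⟩
  rw [IntegrableOn, Measure.restrict_smul]
  exact hs.2.smul_measure ENNReal.ofReal_ne_top

/-! ### Weak solutions and controlled weights -/

/-- Weak solutions `∇_v f = G`, `(∂_t + v · ∇_x) f = ∇_v · S` with locally integrable data. -/
structure IsSol (f : Phase d → ℝ) (G S : Phase d → Sp d) : Prop where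
  loc : LocallyIntegrable f
  locG : LocallyIntegrable G
  locS : LocallyIntegrable S
  grad : IsWeakGradV f G
  eq : TransportEqDivV f S

lemma fderiv_comp_kinMap {ψ : Phase d → ℝ} (hψ : Differentiable ℝ ψ) (z : Phase d) (T V : ℝ)
    (w u : Phase d) :
    fderiv ℝ (fun w => ψ (kinMap z T V w)) w u = fderiv ℝ ψ (kinMap z T V w) (kinLin z T V u) := by
  have h1 : HasFDerivAt (kinMap z T V) (kinLin z T V) w :=
    (kinLin z T V).hasFDerivAt.const_add z
  exact congrArg (fun L => L u) ((hψ _).hasFDerivAt.comp w h1).fderiv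

lemma gradV_comp_kinMap {ψ : Phase d → ℝ} (hψ : Differentiable ℝ ψ) (z : Phase d) (T V : ℝ)
    (w : Phase d) :
    gradV (fun w => ψ (kinMap z T V w)) w = V • gradV ψ (kinMap z T V w) := by
  ext i
  have : kinLin z T V (0, 0, EuclideanSpace.single i 1) =
      V • ((0, 0, EuclideanSpace.single i 1) : Phase d) := by simp
  simp only [gradV, PiLp.smul_apply, smul_eq_mul]
  rw [fderiv_comp_kinMap hψ, this, map_smul, smul_eq_mul]

lemma transport_comp_kinMap {ψ : Phase d → ℝ} (hψ : Differentiable ℝ ψ) (z : Phase d) (T V : ℝ)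
    (w : Phase d) :
    transport (fun w => ψ (kinMap z T V w)) w = T * transport ψ (kinMap z T V w) := by
  have : kinLin z T V (1, w.2.2, 0) = T • ((1, (kinMap z T V w).2.2, 0) : Phase d) := by
    simp [kinMap_apply, smul_smul, add_comm]
  simp only [transport]
  rw [fderiv_comp_kinMap hψ, this, map_smul, smul_eq_mul]

/-- The class of weak solutions is invariant under Galilean translations and kinetic dilations. -/
lemma IsSol.comp_kinMap {f : Phase d → ℝ} {G S : Phase d → Sp d} (h : IsSol f G S)
    (z : Phase d) {T V : ℝ} (hT : 0 < T) (hV : 0 < V) :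
    IsSol (fun w => f (kinMap z T V w)) (fun w => V • G (kinMap z T V w))
      (fun w => (T / V) • S (kinMap z T V w)) where
  loc := locallyIntegrable_comp_kinMap h.loc z hT hV
  locG := (locallyIntegrable_comp_kinMap h.locG z hT hV).smul V
  locS := (locallyIntegrable_comp_kinMap h.locS z hT hV).smul (T / V)
  grad := by
    intro φ hφ i
    obtain ⟨ψ, hψ, rfl⟩ : ∃ ψ, IsTest ψ ∧ φ = fun w => ψ (kinMap z T V w) :=
      ⟨fun u => φ (kinInv z T V u), ⟨hφ.1.comp (contDiff_kinInv z T V),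
        hφ.2.comp_homeomorph (kinHomeo z hT.ne' hV.ne').symm⟩, by
          ext w; exact congrArg φ (kinInv_kinMap z hT.ne' hV.ne' w).symm⟩
    have hd : Differentiable ℝ ψ := hψ.1.differentiable (by simp)
    simp only [gradV_comp_kinMap hd, PiLp.smul_apply, smul_eq_mul]
    have e1 := integral_kinMap z hT hV fun u => V * (f u * gradV ψ u i)
    have e2 := integral_kinMap z hT hV fun u => V * (G u i * ψ u)
    simp only [mul_left_comm _ V, mul_assoc V]
    rw [e1, e2, integral_const_mul, integral_const_mul, h.grad ψ hψ i]
    ring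
  eq := by
    intro φ hφ
    obtain ⟨ψ, hψ, rfl⟩ : ∃ ψ, IsTest ψ ∧ φ = fun w => ψ (kinMap z T V w) :=
      ⟨fun u => φ (kinInv z T V u), ⟨hφ.1.comp (contDiff_kinInv z T V),
        hφ.2.comp_homeomorph (kinHomeo z hT.ne' hV.ne').symm⟩, by
          ext w; exact congrArg φ (kinInv_kinMap z hT.ne' hV.ne' w).symm⟩
    have hd : Differentiable ℝ ψ := hψ.1.differentiable (by simp)
    simp only [gradV_comp_kinMap hd, transport_comp_kinMap hd, inner_smul_left, inner_smul_right]
    have e1 := integral_kinMap z hT hV fun u => T * (f u * transport ψ u)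
    have e2 := integral_kinMap z hT hV fun u => T * inner ℝ (S u) (gradV ψ u)
    have e3 : ∀ r : ℝ, V * ((starRingEnd ℝ) (T / V) * r) = T * r := fun r => by
      simp; field_simp
    simp only [mul_left_comm _ T, e3]
    rw [e1, e2, integral_const_mul, integral_const_mul]
    linear_combination (jac d T V)⁻¹ * T * h.eq ψ hψ

/-- Smooth functions supported in the closed ball of radius `R` around the origin. -/
def IsTestIn (R : ℝ) (φ : Phase d → ℝ) : Prop :=
  ContDiff ℝ ∞ φ ∧ tsupport φ ⊆ Metric.closedBall 0 R

/-- The derivative `∂_{x_i} φ`. -/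
noncomputable def derivX (i : Fin d) (φ : Phase d → ℝ) (z : Phase d) : ℝ :=
  fderiv ℝ φ z (0, EuclideanSpace.single i 1, 0)

lemma IsTestIn.hasCompactSupport {R : ℝ} {φ : Phase d → ℝ} (h : IsTestIn R φ) :
    HasCompactSupport φ :=
  (isCompact_closedBall 0 R).of_isClosed_subset (isClosed_tsupport φ) h.2

lemma IsTestIn.isTest {R : ℝ} {φ : Phase d → ℝ} (h : IsTestIn R φ) : IsTest φ :=
  ⟨h.1, h.hasCompactSupport⟩

lemma IsTestIn.mul_left {R : ℝ} {φ a : Phase d → ℝ} (h : IsTestIn R φ) (ha : ContDiff ℝ ∞ a) :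
    IsTestIn R fun z => a z * φ z :=
  ⟨ha.mul h.1, (tsupport_mul_subset_right (f := a)).trans h.2⟩

lemma IsTestIn.fderiv {R : ℝ} {φ : Phase d → ℝ} (h : IsTestIn R φ) {u : Phase d → Phase d}
    (hu : ContDiff ℝ ∞ u) : IsTestIn R fun z => fderiv ℝ φ z (u z) := by
  refine ⟨(h.1.fderiv_right (m := ∞) (by simp)).clm_apply hu, ?_⟩
  refine (closure_mono fun z hz => ?_).trans ((tsupport_fderiv_subset ℝ).trans h.2)
  contrapose! hz
  simp [Function.notMem_support.1 hz]

lemma IsTestIn.transport {R : ℝ} {φ : Phase d → ℝ} (h : IsTestIn R φ) :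
    IsTestIn R (transport φ) :=
  h.fderiv (by fun_prop)

lemma IsTestIn.gradV {R : ℝ} {φ : Phase d → ℝ} (h : IsTestIn R φ) (i : Fin d) :
    IsTestIn R fun z => gradV φ z i :=
  h.fderiv contDiff_const

lemma IsTestIn.derivX {R : ℝ} {φ : Phase d → ℝ} (h : IsTestIn R φ) (i : Fin d) :
    IsTestIn R (derivX i φ) :=
  h.fderiv contDiff_const

lemma gradV_transport {φ : Phase d → ℝ} (h : ContDiff ℝ ∞ φ) (i : Fin d) (z : Phase d) :
    gradV (transport φ) z i = derivX i φ z + transport (fun z => gradV φ z i) z := by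
  have h2 : DifferentiableAt ℝ (fderiv ℝ φ) z :=
    (h.fderiv_right (m := 1) (by norm_cast)).differentiable (by simp) z
  have hs : IsSymmSndFDerivAt ℝ φ z :=
    h.contDiffAt.isSymmSndFDerivAt (by
    rw [minSmoothness_of_isRCLikeNormedField]
    exact WithTop.coe_le_coe.2 (le_top : (2 : ℕ∞) ≤ ⊤))
  let M : Phase d →L[ℝ] Phase d :=
    (0 : Phase d →L[ℝ] ℝ).prod (((ContinuousLinearMap.snd ℝ (Sp d) (Sp d)).comp
      (ContinuousLinearMap.snd ℝ ℝ (Sp d × Sp d))).prod 0)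
  have hu : HasFDerivAt (fun z : Phase d => ((1, z.2.2, 0) : Phase d)) M z := by
    have : (fun z : Phase d => ((1, z.2.2, 0) : Phase d)) = fun z => (1, 0, 0) + M z := by
      ext <;> simp [M]
    rw [this]
    exact M.hasFDerivAt.const_add _
  have e1 := (h2.hasFDerivAt.clm_apply hu).fderiv
  have e2 := (h2.hasFDerivAt.clm_apply
    (hasFDerivAt_const ((0, 0, EuclideanSpace.single i 1) : Phase d) z)).fderiv
  change _root_.fderiv ℝ (fun z => _root_.fderiv ℝ φ z (1, z.2.2, 0)) z
      (0, 0, EuclideanSpace.single i 1) = _ +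
    _root_.fderiv ℝ (fun z => _root_.fderiv ℝ φ z (0, 0, EuclideanSpace.single i 1)) z (1, z.2.2, 0)
  rw [e1, e2]
  simp [M, Kinetic.derivX, hs.eq (1, z.2.2, 0)]

lemma IsTestIn.exists_bound {R : ℝ} {φ : Phase d → ℝ} (h : IsTestIn R φ) :
    ∃ C : NNReal, ∀ z, ‖φ z‖ₑ ≤ C := by
  obtain ⟨C, hC⟩ := h.1.continuous.bounded_above_of_compact_support h.hasCompactSupport
  exact ⟨C.toNNReal, fun z => by
    rw [← ofReal_norm]; exact ENNReal.ofReal_le_ofReal (hC z)⟩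

lemma IsTestIn.eq_zero {R : ℝ} {φ : Phase d → ℝ} (h : IsTestIn R φ) {z : Phase d}
    (hz : z ∉ Metric.closedBall 0 R) : φ z = 0 :=
  image_eq_zero_of_notMem_tsupport fun h' => hz (h.2 h')

lemma IsTestIn.enorm_integral_le {R : ℝ} {φ : Phase d → ℝ} (h : IsTestIn R φ) :
    ∃ C : NNReal, ∀ (H : Phase d → Sp d) (i : Fin d),
      ‖∫ z, H z i * φ z‖ₑ ≤ C * ∫⁻ z in Metric.closedBall 0 R, ‖H z‖ₑ := by
  obtain ⟨C, hC⟩ := h.exists_bound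
  refine ⟨C, fun H i => (enorm_integral_le_lintegral_enorm _).trans ?_⟩
  rw [← lintegral_indicator Metric.isClosed_closedBall.measurableSet,
    ← lintegral_const_mul' _ _ ENNReal.coe_ne_top]
  refine lintegral_mono fun z => ?_
  by_cases hz : z ∈ Metric.closedBall 0 R
  · rw [Set.indicator_of_mem hz, enorm_mul, mul_comm]
    gcongr
    · exact hC z
    · rw [enorm_le_iff_norm_le]
      exact PiLp.norm_apply_le (H z) i
  · simp [h.eq_zero hz]

/-- A continuous weight `ψ` is controlled when the pairing `∫ f ψ` of any weak solution with `ψ`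
is bounded by the mass of `∇_v f` and of the source in a fixed ball. -/
def Controlled (R : ℝ) (ψ : Phase d → ℝ) : Prop :=
  ∃ C : NNReal, ∀ (f : Phase d → ℝ) (G S : Phase d → Sp d), IsSol f G S →
    ‖∫ z, f z * ψ z‖ₑ ≤ C * ∫⁻ z in Metric.closedBall 0 R, (‖G z‖ₑ + ‖S z‖ₑ)

lemma IsTestIn.integrable_mul {R : ℝ} {φ : Phase d → ℝ} (h : IsTestIn R φ) {f : Phase d → ℝ}
    (hf : LocallyIntegrable f) : Integrable fun z => f z * φ z :=
  hf.integrable_smul_right_of_hasCompactSupport h.1.continuous h.hasCompactSupport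

lemma Controlled.add {R : ℝ} {φ ψ : Phase d → ℝ} (tφ : IsTestIn R φ) (tψ : IsTestIn R ψ)
    (hφ : Controlled R φ) (hψ : Controlled R ψ) : Controlled R fun z => φ z + ψ z := by
  obtain ⟨C, hC⟩ := hφ
  obtain ⟨D, hD⟩ := hψ
  refine ⟨C + D, fun f G S h => ?_⟩
  simp only [mul_add]
  rw [integral_add (tφ.integrable_mul h.loc) (tψ.integrable_mul h.loc), ENNReal.coe_add, add_mul]
  exact (enorm_add_le _ _).trans (add_le_add (hC f G S h) (hD f G S h))

lemma Controlled.const_mul {R : ℝ} {φ : Phase d → ℝ} (c : ℝ) (hφ : Controlled R φ) :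
    Controlled R fun z => c * φ z := by
  obtain ⟨C, hC⟩ := hφ
  refine ⟨‖c‖₊ * C, fun f G S h => ?_⟩
  simp only [mul_left_comm _ c]
  rw [integral_const_mul, enorm_mul, ENNReal.coe_mul, mul_assoc]
  exact mul_le_mul_right (hC f G S h) _

lemma IsTestIn.add {R : ℝ} {φ ψ : Phase d → ℝ} (tφ : IsTestIn R φ) (tψ : IsTestIn R ψ) :
    IsTestIn R fun z => φ z + ψ z :=
  ⟨tφ.1.add tψ.1, (tsupport_add φ ψ).trans (Set.union_subset tφ.2 tψ.2)⟩

lemma isTestIn_zero (R : ℝ) : IsTestIn R fun _ : Phase d => (0 : ℝ) :=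
  ⟨contDiff_const, by simp [tsupport]⟩

lemma controlled_sum {R : ℝ} {φ : Fin d → Phase d → ℝ} (t : ∀ i, IsTestIn R (φ i))
    (h : ∀ i, Controlled R (φ i)) (s : Finset (Fin d)) :
    IsTestIn R (fun z => ∑ i ∈ s, φ i z) ∧ Controlled R fun z => ∑ i ∈ s, φ i z := by
  induction s using Finset.cons_induction with
  | empty => exact ⟨by simpa using isTestIn_zero R, 0, fun f G S h => by simp⟩
  | cons i s hi ih =>
    simp only [Finset.sum_cons]
    exact ⟨(t i).add ih.1, Controlled.add (t i) ih.1 (h i) ih.2⟩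

lemma IsTestIn.controlled_gradV {R : ℝ} {φ : Phase d → ℝ} (h : IsTestIn R φ) (i : Fin d) :
    Controlled R fun z => Kinetic.gradV φ z i := by
  obtain ⟨C, hC⟩ := h.enorm_integral_le
  refine ⟨C, fun f G S hf => ?_⟩
  rw [hf.grad φ h.isTest i, enorm_neg]
  refine (hC G i).trans ?_
  gcongr
  exact le_self_add

lemma IsTestIn.controlled_transport {R : ℝ} {φ : Phase d → ℝ} (h : IsTestIn R φ) :
    Controlled R (Kinetic.transport φ) := by
  choose C hC using fun i => (h.gradV i).enorm_integral_le
  refine ⟨∑ i, C i, fun f G S hf => ?_⟩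
  rw [neg_inj.1 (hf.eq φ h.isTest)]
  have e : ∀ z, inner ℝ (S z) (Kinetic.gradV φ z) = ∑ i, S z i * Kinetic.gradV φ z i := fun z => by
    rw [PiLp.inner_apply]
    exact Finset.sum_congr rfl fun i _ => by simp [mul_comm]
  simp only [e]
  rw [integral_finsetSum, ENNReal.ofNNReal_finsetSum, Finset.sum_mul]
  · refine (enorm_sum_le _ _).trans (Finset.sum_le_sum fun i _ => (hC i S i).trans ?_)
    gcongr
    exact le_add_self
  · intro i _
    refine LocallyIntegrable.integrable_smul_right_of_hasCompactSupport (f := fun z => S z i) ?_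
      (h.gradV i).1.continuous (h.gradV i).hasCompactSupport
    exact fun x => (hf.locS x).imp fun s hs =>
      ⟨hs.1, (EuclideanSpace.proj (𝕜 := ℝ) i).integrable_comp hs.2⟩

/-- Position derivatives are commutators, `∂_{x_i} = [∂_{v_i}, ∂_t + v · ∇_x]`, hence they are
controlled although the equation says nothing about them directly. -/
lemma IsTestIn.controlled_derivX {R : ℝ} {φ : Phase d → ℝ} (h : IsTestIn R φ) (i : Fin d) :
    Controlled R (Kinetic.derivX i φ) := by
  have e : Kinetic.derivX i φ = fun z => Kinetic.gradV (Kinetic.transport φ) z i +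
      (-1) * Kinetic.transport (fun z => Kinetic.gradV φ z i) z := by
    ext z; rw [gradV_transport h.1]; ring
  rw [e]
  exact Controlled.add (h.transport.gradV i) ((h.gradV i).transport.mul_left contDiff_const)
    (h.transport.controlled_gradV i) ((h.gradV i).controlled_transport.const_mul (-1))

/-! ### Perturbations of the mollifier -/

lemma fderiv_mul_apply_of_hasFDerivAt {a φ : Phase d → ℝ} {z : Phase d} {a' : Phase d →L[ℝ] ℝ}
    (ha : HasFDerivAt a a' z) (hφ : Differentiable ℝ φ) (u : Phase d) :
    fderiv ℝ (fun z => a z * φ z) z u = a z * fderiv ℝ φ z u + a' u * φ z := by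
  rw [(ha.fun_mul (hφ z).hasFDerivAt).fderiv]
  simp [mul_comm]

lemma map_x_eq_sum (L : Phase d →L[ℝ] ℝ) (x : Sp d) :
    L (0, x, 0) = ∑ i, x i * L (0, EuclideanSpace.single i 1, 0) := by
  have h : x = ∑ i, x i • EuclideanSpace.single i (1 : ℝ) := by
    simpa using ((EuclideanSpace.basisFun (Fin d) ℝ).sum_repr x).symm
  let M : Sp d →L[ℝ] ℝ := L.comp
    ((ContinuousLinearMap.inr ℝ ℝ (Sp d × Sp d)).comp (ContinuousLinearMap.inl ℝ (Sp d) (Sp d)))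
  change M x = ∑ i, x i * M (EuclideanSpace.single i 1)
  conv_lhs => rw [h]
  simp only [map_sum, map_smul, smul_eq_mul]

lemma map_v_eq_sum (L : Phase d →L[ℝ] ℝ) (v : Sp d) :
    L (0, 0, v) = ∑ i, v i * L (0, 0, EuclideanSpace.single i 1) := by
  have h : v = ∑ i, v i • EuclideanSpace.single i (1 : ℝ) := by
    simpa using ((EuclideanSpace.basisFun (Fin d) ℝ).sum_repr v).symm
  let M : Sp d →L[ℝ] ℝ := L.comp
    ((ContinuousLinearMap.inr ℝ ℝ (Sp d × Sp d)).comp (ContinuousLinearMap.inr ℝ (Sp d) (Sp d)))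
  change M v = ∑ i, v i * M (EuclideanSpace.single i 1)
  conv_lhs => rw [h]
  simp only [map_sum, map_smul, smul_eq_mul]

/-- The generator `div (w ↦ (τ t, x, (1 - τ) v) φ)` of the mass-preserving action on `φ` of the
dilations with exponents `τ`, `1`, `1 - τ` in time, position and velocity. -/
noncomputable def euler (τ : ℝ) (φ : Phase d → ℝ) (z : Phase d) : ℝ :=
  (τ + d + (1 - τ) * d) * φ z + fderiv ℝ φ z (τ * z.1, z.2.1, (1 - τ) • z.2.2)

lemma euler_eq (τ : ℝ) {φ : Phase d → ℝ} (h : Differentiable ℝ φ) (z : Phase d) :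
    euler τ φ z = (τ * transport (fun z => z.1 * φ z) z +
        ∑ i, derivX i (fun z => (z.2.1 i - τ * (z.1 * z.2.2 i)) * φ z) z) +
      (1 - τ) * ∑ i, gradV (fun z => z.2.2 i * φ z) z i := by
  have e1 : transport (fun z : Phase d => z.1 * φ z) z =
      z.1 * fderiv ℝ φ z (1, z.2.2, 0) + φ z := by
    have := fderiv_mul_apply_of_hasFDerivAt
      (ContinuousLinearMap.fst ℝ ℝ (Sp d × Sp d)).hasFDerivAt h
      (z := z) (1, z.2.2, 0)
    simpa [transport] using this
  have hv : ∀ i, HasFDerivAt (fun z : Phase d => z.2.2 i)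
      ((EuclideanSpace.proj (𝕜 := ℝ) i).comp ((ContinuousLinearMap.snd ℝ (Sp d) (Sp d)).comp
        (ContinuousLinearMap.snd ℝ ℝ (Sp d × Sp d)))) z := fun i =>
    ContinuousLinearMap.hasFDerivAt ((EuclideanSpace.proj (𝕜 := ℝ) i).comp
      ((ContinuousLinearMap.snd ℝ (Sp d) (Sp d)).comp (ContinuousLinearMap.snd ℝ ℝ (Sp d × Sp d))))
  have hx : ∀ i, HasFDerivAt (fun z : Phase d => z.2.1 i)
      ((EuclideanSpace.proj (𝕜 := ℝ) i).comp ((ContinuousLinearMap.fst ℝ (Sp d) (Sp d)).comp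
        (ContinuousLinearMap.snd ℝ ℝ (Sp d × Sp d)))) z := fun i =>
    ContinuousLinearMap.hasFDerivAt ((EuclideanSpace.proj (𝕜 := ℝ) i).comp
      ((ContinuousLinearMap.fst ℝ (Sp d) (Sp d)).comp (ContinuousLinearMap.snd ℝ ℝ (Sp d × Sp d))))
  have ht : HasFDerivAt (fun z : Phase d => z.1) (ContinuousLinearMap.fst ℝ ℝ (Sp d × Sp d)) z :=
    (ContinuousLinearMap.fst ℝ ℝ (Sp d × Sp d)).hasFDerivAt
  have e2 : ∀ i, derivX i (fun z : Phase d => (z.2.1 i - τ * (z.1 * z.2.2 i)) * φ z) z =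
      (z.2.1 - (τ * z.1) • z.2.2) i * fderiv ℝ φ z (0, EuclideanSpace.single i 1, 0) + φ z :=
    fun i => by
    have := fderiv_mul_apply_of_hasFDerivAt ((hx i).fun_sub ((ht.fun_mul (hv i)).const_mul τ)) h
      (0, EuclideanSpace.single i 1, 0)
    simpa [derivX, mul_assoc] using this
  have e3 : ∀ i, gradV (fun z : Phase d => z.2.2 i * φ z) z i =
      z.2.2 i * fderiv ℝ φ z (0, 0, EuclideanSpace.single i 1) + φ z := fun i => by
    have := fderiv_mul_apply_of_hasFDerivAt (hv i) h (0, 0, EuclideanSpace.single i 1)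
    simpa [gradV] using this
  simp only [e1, e2, e3, Finset.sum_add_distrib, Finset.sum_const, Finset.card_univ,
    Fintype.card_fin, nsmul_eq_mul]
  rw [← map_x_eq_sum, ← map_v_eq_sum, euler]
  have e4 : ((τ * z.1, z.2.1, (1 - τ) • z.2.2) : Phase d) =
      (τ * z.1) • ((1, z.2.2, 0) : Phase d) + (0, z.2.1 - (τ * z.1) • z.2.2, 0) +
        (1 - τ) • ((0, 0, z.2.2) : Phase d) := by
    ext <;> simp
  rw [e4, map_add, map_add, map_smul, map_smul, smul_eq_mul, smul_eq_mul]
  ring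

lemma IsTestIn.euler {R : ℝ} {φ : Phase d → ℝ} (h : IsTestIn R φ) (τ : ℝ) :
    IsTestIn R (euler τ φ) :=
  (h.mul_left contDiff_const).add (h.fderiv (by fun_prop))

lemma IsTestIn.controlled_euler {R : ℝ} {φ : Phase d → ℝ} (h : IsTestIn R φ) (τ : ℝ) :
    Controlled R (Kinetic.euler τ φ) := by
  have t1 : IsTestIn R fun z : Phase d => z.1 * φ z := h.mul_left (by fun_prop)
  have t2 : ∀ i, IsTestIn R fun z : Phase d => (z.2.1 i - τ * (z.1 * z.2.2 i)) * φ z :=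
    fun i => h.mul_left (by fun_prop)
  have t3 : ∀ i, IsTestIn R fun z : Phase d => z.2.2 i * φ z := fun i => h.mul_left (by fun_prop)
  have c2 := controlled_sum (fun i => (t2 i).derivX i) (fun i => (t2 i).controlled_derivX i)
    Finset.univ
  have c3 := controlled_sum (fun i => (t3 i).gradV i) (fun i => (t3 i).controlled_gradV i)
    Finset.univ
  have t4 := t1.transport.mul_left (contDiff_const (c := τ))
  rw [show Kinetic.euler τ φ = _ from funext (euler_eq τ (h.1.differentiable (by simp)))]
  exact Controlled.add (t4.add c2.1) (c3.1.mul_left contDiff_const)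
    (Controlled.add t4 c2.1 (t1.controlled_transport.const_mul τ) c2.2) (c3.2.const_mul (1 - τ))

/-- Mean value inequality for `θ ↦ ∫ f k_θ`, where `k_θ` is a differentiable path of weights. -/
lemma enorm_integral_path_sub_le {k k' : ℝ → Phase d → ℝ} {R M : ℝ} {D : ℝ≥0∞} {f : Phase d → ℝ}
    (hf : LocallyIntegrable f) (hk : ∀ θ, Continuous (k θ)) (hk' : ∀ θ, Continuous (k' θ))
    (hd : ∀ θ w, HasDerivAt (fun θ => k θ w) (k' θ w) θ)
    (hM : ∀ θ ∈ Set.Ioo (-1 : ℝ) 2, ∀ w, ‖k' θ w‖ ≤ M)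
    (hR : ∀ θ ∈ Set.Ioo (-1 : ℝ) 2, ∀ w, w ∉ Metric.closedBall 0 R → k θ w = 0 ∧ k' θ w = 0)
    (hD : ∀ θ ∈ Set.Icc (0 : ℝ) 1, ‖∫ w, f w * k' θ w‖ₑ ≤ D) :
    ‖(∫ w, f w * k 1 w) - ∫ w, f w * k 0 w‖ₑ ≤ D := by
  rcases eq_or_ne D ⊤ with rfl | hDt
  · exact le_top
  have hf' : IntegrableOn f (Metric.closedBall 0 R) :=
    hf.integrableOn_isCompact (isCompact_closedBall 0 R)
  have key : ∀ θ ∈ Set.Icc (0 : ℝ) 1,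
      HasDerivAt (fun θ => ∫ w, f w * k θ w) (∫ w, f w * k' θ w) θ := by
    intro θ hθ
    have hθ' : θ ∈ Set.Ioo (-1 : ℝ) 2 := ⟨by linarith [hθ.1], by linarith [hθ.2]⟩
    refine (hasDerivAt_integral_of_dominated_loc_of_deriv_le
      (s := Set.Ioo (-1 : ℝ) 2) (F := fun θ w => f w * k θ w) (F' := fun θ w => f w * k' θ w)
      (bound := (Metric.closedBall 0 R).indicator fun w => ‖f w‖ * M)
      (Ioo_mem_nhds hθ'.1 hθ'.2) (Filter.Eventually.of_forall fun θ =>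
        hf.aestronglyMeasurable.mul (hk θ).aestronglyMeasurable) ?_
      (hf.aestronglyMeasurable.mul (hk' θ).aestronglyMeasurable)
      (Filter.Eventually.of_forall fun w x hx => ?_)
      ((integrable_indicator_iff Metric.isClosed_closedBall.measurableSet).2
        (hf'.norm.mul_const M))
      (Filter.Eventually.of_forall fun w x _ => (hd x w).const_mul (f w))).2
    · refine hf.integrable_smul_right_of_hasCompactSupport (hk θ)
        (HasCompactSupport.intro (isCompact_closedBall 0 R) fun w hw => (hR θ hθ' w hw).1)
    · by_cases hw : w ∈ Metric.closedBall 0 R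
      · rw [Set.indicator_of_mem hw, norm_mul]
        exact mul_le_mul_of_nonneg_left (hM x hx w) (norm_nonneg _)
      · simp [hw, (hR x hx w hw).2]
  have h := norm_image_sub_le_of_norm_deriv_le_segment_01'
    (fun x hx => (key x hx).hasDerivWithinAt) (C := D.toReal)
    (fun x hx => by
      rw [← toReal_enorm]
      exact ENNReal.toReal_mono hDt (hD x ⟨hx.1, hx.2.le⟩))
  rw [← ofReal_norm]
  exact ENNReal.ofReal_le_of_le_toReal h

lemma setLIntegral_kinMap_le {R R' : ℝ} (z : Phase d) {T V : ℝ} (hT : 0 < T) (hV : 0 < V)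
    (hB : ∀ w ∈ Metric.closedBall (0 : Phase d) R, kinMap z T V w ∈ Metric.closedBall 0 R')
    (g : Phase d → ℝ≥0∞) :
    ∫⁻ w in Metric.closedBall 0 R, g (kinMap z T V w) ≤
      ENNReal.ofReal (jac d T V)⁻¹ * ∫⁻ w in Metric.closedBall 0 R', g w := by
  rw [← lintegral_indicator Metric.isClosed_closedBall.measurableSet,
    ← lintegral_indicator Metric.isClosed_closedBall.measurableSet, ← lintegral_kinMap z hT hV]
  refine lintegral_mono fun w => ?_
  by_cases hw : w ∈ Metric.closedBall (0 : Phase d) R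
  · simp [Set.indicator_of_mem hw, Set.indicator_of_mem (hB w hw)]
  · simp [Set.indicator_of_notMem hw]

lemma norm_kinMap_zero_le {T V c : ℝ} (hT : 0 < T) (hV : 0 < V) (hTc : T ≤ c) (hVc : V ≤ c)
    (hTV : T * V ≤ c) (w : Phase d) : ‖kinMap 0 T V w‖ ≤ c * ‖w‖ := by
  have h1 : ‖w.1‖ ≤ ‖w‖ := norm_fst_le w
  have h2 : ‖w.2.1‖ ≤ ‖w‖ := (norm_fst_le w.2).trans (norm_snd_le w)
  have h3 : ‖w.2.2‖ ≤ ‖w‖ := (norm_snd_le w.2).trans (norm_snd_le w)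
  have hc : 0 ≤ c := hT.le.trans hTc
  rw [kinMap_zero_apply, Prod.norm_def, Prod.norm_def]
  refine max_le ?_ (max_le ?_ ?_)
  · rw [norm_mul, Real.norm_of_nonneg hT.le]; gcongr
  · rw [norm_smul, Real.norm_of_nonneg (mul_pos hT hV).le]; gcongr
  · rw [norm_smul, Real.norm_of_nonneg hV.le]; gcongr

/-- The dilation by `e^{-τσ}` in time, `e^{-σ}` in position and `e^{-(1-τ)σ}` in velocity. -/
noncomputable def dil (τ σ : ℝ) : Phase d → Phase d :=
  kinMap 0 (Real.exp (-(τ * σ))) (Real.exp (-((1 - τ) * σ)))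

lemma norm_shift (h : Sp d) : ‖((0, h, 0) : Phase d)‖ = ‖h‖ := by
  simp [Prod.norm_def]

lemma jac_exp (τ σ : ℝ) : (jac d (Real.exp (-(τ * σ))) (Real.exp (-((1 - τ) * σ))))⁻¹ =
    Real.exp ((τ + d + (1 - τ) * d) * σ) := by
  rw [jac, ← Real.exp_add, ← Real.exp_nat_mul, ← Real.exp_nat_mul, ← Real.exp_add, ← Real.exp_add,
    ← Real.exp_neg]
  congr 1; ring

lemma dil_apply (τ σ : ℝ) (w : Phase d) : dil τ σ w =
    (Real.exp (-(τ * σ)) * w.1, Real.exp (-σ) • w.2.1, Real.exp (-((1 - τ) * σ)) • w.2.2) := by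
  rw [dil, kinMap_zero_apply, ← Real.exp_add]
  congr 4; ring

lemma dil_neg_dil (τ σ : ℝ) (w : Phase d) : dil τ (-σ) (dil τ σ w) = w := by
  simp only [dil_apply, smul_smul, ← mul_assoc, ← Real.exp_add]
  simp

lemma norm_dil_le {τ σ : ℝ} (hτ : 0 ≤ τ) (hτ' : τ ≤ 1) {m : ℝ} (hm : 0 ≤ m) (hσ : -σ ≤ m)
    (w : Phase d) : ‖dil τ σ w‖ ≤ Real.exp m * ‖w‖ := by
  refine norm_kinMap_zero_le (Real.exp_pos _) (Real.exp_pos _) ?_ ?_ ?_ w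
  · exact Real.exp_le_exp.2 (by nlinarith)
  · exact Real.exp_le_exp.2 (by nlinarith)
  · rw [← Real.exp_add]
    exact Real.exp_le_exp.2 (by nlinarith)

lemma hasDerivAt_dil_neg (τ σ : ℝ) (w : Phase d) :
    HasDerivAt (fun σ => dil τ (-σ) w) (τ * (dil τ (-σ) w).1, (dil τ (-σ) w).2.1,
      (1 - τ) • (dil τ (-σ) w).2.2) σ := by
  simp only [dil_apply]
  have h : ∀ c : ℝ, HasDerivAt (fun σ => Real.exp (-(c * -σ))) (c * Real.exp (-(c * -σ))) σ :=
    fun c => by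
      have := ((hasDerivAt_id σ).const_mul c).exp
      simpa [mul_comm] using this
  refine HasDerivAt.prodMk ?_ (HasDerivAt.prodMk ?_ ?_)
  · rw [← mul_assoc]; exact (h τ).mul_const _
  · have := (h 1).smul_const w.2.1
    simpa using this
  · rw [smul_smul]; exact (h (1 - τ)).smul_const _

/-- Dilating the mollifier by a fixed factor changes the mollification of a weak solution by at
most the mass of `∇_v f` and of the source in a fixed ball. -/
lemma IsTestIn.dil_sub_controlled {K : Phase d → ℝ} (hK : IsTestIn 1 K) {τ : ℝ}
    (hτ : 0 ≤ τ) (hτ' : τ ≤ 1) :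
    ∃ C : NNReal, ∀ (f : Phase d → ℝ) (G S : Phase d → Sp d), IsSol f G S →
      ‖(∫ w, f (dil τ 1 w) * K w) - ∫ w, f w * K w‖ₑ ≤
        C * ∫⁻ w in Metric.closedBall 0 1, (‖G w‖ₑ + ‖S w‖ₑ) := by
  set Q : ℝ := τ + d + (1 - τ) * d with hQ
  have hQ0 : 0 ≤ Q := by
    have : 0 ≤ (1 - τ) * (d : ℝ) := mul_nonneg (by linarith) (Nat.cast_nonneg d)
    positivity
  obtain ⟨C, hC⟩ := hK.controlled_euler τ
  obtain ⟨M, hM⟩ := (hK.euler τ).exists_bound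
  have hdc : ∀ σ, Continuous (dil τ σ : Phase d → Phase d) := fun σ => continuous_kinMap _ _ _
  -- A change of variables moves the dilation from `f` onto the weight, where it can be
  -- differentiated; `exp (Q * σ)` is the inverse Jacobian of `dil τ σ`.
  have change : ∀ (f φ : Phase d → ℝ) σ, ∫ w, f w * (Real.exp (Q * σ) * φ (dil τ (-σ) w)) =
      ∫ w, f (dil τ σ w) * φ w := fun f φ σ => by
    have := integral_kinMap (0 : Phase d) (Real.exp_pos (-(τ * σ)))
      (Real.exp_pos (-((1 - τ) * σ))) fun w => f w * φ (dil τ (-σ) w)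
    rw [jac_exp, ← integral_const_mul] at this
    simp only [mul_left_comm (f _)]
    rw [← this]
    refine integral_congr_ae (Filter.Eventually.of_forall fun w => ?_)
    change f (dil τ σ w) * φ (dil τ (-σ) (dil τ σ w)) = _
    rw [dil_neg_dil]
  refine ⟨C * (Real.exp 1 * Real.exp Q).toNNReal, fun f G S h => ?_⟩
  have e1 := change f K 1
  have e0 := change f K 0
  have e00 : ∀ w : Phase d, dil τ 0 w = w := fun w => by simp [dil_apply]
  simp only [e00] at e0
  rw [← e1, ← e0]
  refine enorm_integral_path_sub_le (k := fun σ w => Real.exp (Q * σ) * K (dil τ (-σ) w))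
    (k' := fun σ w => Real.exp (Q * σ) * Kinetic.euler τ K (dil τ (-σ) w))
    (R := Real.exp 1) (M := Real.exp (Q * 2) * M) h.loc
    (fun σ => continuous_const.mul (hK.1.continuous.comp (hdc _)))
    (fun σ => continuous_const.mul ((hK.euler τ).1.continuous.comp (hdc _))) ?_ ?_ ?_ ?_
  · intro σ w
    have a1 : HasDerivAt (fun σ => Real.exp (Q * σ)) (Q * Real.exp (Q * σ)) σ := by
      simpa [mul_comm] using ((hasDerivAt_id σ).const_mul Q).exp
    have a2 := ((hK.1.differentiable (by simp) (dil τ (-σ) w)).hasFDerivAt).comp_hasDerivAt σ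
      (hasDerivAt_dil_neg τ σ w)
    refine (a1.mul a2).congr_deriv ?_
    simp only [Kinetic.euler, Function.comp_apply, ← hQ]
    ring
  · intro σ hσ w
    rw [norm_mul, Real.norm_of_nonneg (Real.exp_pos _).le]
    gcongr
    · exact hσ.2.le
    · have := hM (dil τ (-σ) w)
      rwa [enorm_le_coe] at this
  · intro σ hσ w hw
    have : dil τ (-σ) w ∉ Metric.closedBall (0 : Phase d) 1 := by
      contrapose! hw
      rw [mem_closedBall_zero_iff] at hw ⊢
      have e : dil τ σ (dil τ (-σ) w) = w := by
        simpa using dil_neg_dil τ (-σ) w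
      rw [← e]
      refine (norm_dil_le hτ hτ' zero_le_one (by linarith [hσ.1]) _).trans ?_
      exact mul_le_of_le_one_right (Real.exp_pos _).le hw
    simp only [hK.eq_zero this, (hK.euler τ).eq_zero this, mul_zero, and_self]
  · intro σ hσ
    rw [change]
    have hTpos := Real.exp_pos (-(τ * σ))
    have hVpos := Real.exp_pos (-((1 - τ) * σ))
    refine (hC _ _ _ (h.comp_kinMap 0 hTpos hVpos)).trans ?_
    rw [ENNReal.coe_mul, mul_assoc]
    gcongr
    have hV1 : Real.exp (-((1 - τ) * σ)) ≤ Real.exp 1 :=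
      Real.exp_le_exp.2 (by nlinarith [hσ.1, hσ.2])
    have hT1 : Real.exp (-(τ * σ)) / Real.exp (-((1 - τ) * σ)) ≤ Real.exp 1 := by
      rw [← Real.exp_sub]
      exact Real.exp_le_exp.2 (by nlinarith [hσ.1, hσ.2])
    have hpt : ∀ w : Phase d,
        ‖Real.exp (-((1 - τ) * σ)) • G (dil τ σ w)‖ₑ +
          ‖(Real.exp (-(τ * σ)) / Real.exp (-((1 - τ) * σ))) • S (dil τ σ w)‖ₑ ≤
        ENNReal.ofReal (Real.exp 1) * (‖G (dil τ σ w)‖ₑ + ‖S (dil τ σ w)‖ₑ) := fun w => by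
      rw [enorm_smul, enorm_smul, mul_add, Real.enorm_of_nonneg hVpos.le,
        Real.enorm_of_nonneg (div_pos hTpos hVpos).le]
      gcongr
    refine (lintegral_mono hpt).trans ?_
    rw [lintegral_const_mul' _ _ ENNReal.ofReal_ne_top]
    have hB : ∀ w ∈ Metric.closedBall (0 : Phase d) 1,
        kinMap 0 (Real.exp (-(τ * σ))) (Real.exp (-((1 - τ) * σ))) w ∈ Metric.closedBall 0 1 := by
      intro w hw
      rw [mem_closedBall_zero_iff] at hw ⊢
      refine (norm_dil_le hτ hτ' le_rfl (by linarith [hσ.1]) w).trans ?_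
      simpa using hw
    refine (mul_le_mul_right (setLIntegral_kinMap_le 0 hTpos hVpos hB
      fun w => ‖G w‖ₑ + ‖S w‖ₑ) _).trans ?_
    rw [jac_exp, ← mul_assoc, ← ENNReal.ofReal_mul (Real.exp_pos _).le]
    change _ ≤ ENNReal.ofReal _ * _
    gcongr
    rw [← hQ]
    nlinarith [hσ.1, hσ.2]

/-- Shifting the mollifier in position by at most one changes the mollification of a weak
solution by at most the mass of `∇_v f` and of the source in a fixed ball. -/
lemma IsTestIn.shift_sub_controlled {K : Phase d → ℝ} (hK : IsTestIn 1 K) :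
    ∃ C : NNReal, ∀ h : Sp d, ‖h‖ ≤ 1 → ∀ (f : Phase d → ℝ) (G S : Phase d → Sp d), IsSol f G S →
      ‖(∫ w, f (kinMap (0, h, 0) 1 1 w) * K w) - ∫ w, f w * K w‖ₑ ≤
        C * ∫⁻ w in Metric.closedBall 0 2, (‖G w‖ₑ + ‖S w‖ₑ) := by
  choose C hC using fun i => hK.controlled_derivX i
  refine ⟨∑ i, C i, fun h hh f G S hf => ?_⟩
  have hDK : IsTestIn 1 fun z => _root_.fderiv ℝ K z (0, h, 0) := hK.fderiv contDiff_const
  obtain ⟨M, hM⟩ := hDK.exists_bound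
  have change : ∀ (f φ : Phase d → ℝ) (h : Sp d), ∫ w, f w * φ (kinMap (0, -h, 0) 1 1 w) =
      ∫ w, f (kinMap (0, h, 0) 1 1 w) * φ w := fun f φ h => by
    have := integral_kinMap ((0, h, 0) : Phase d) one_pos one_pos
      fun w => f w * φ (kinMap (0, -h, 0) 1 1 w)
    simpa [kinMap_shift, jac] using this.symm
  have e1 := change f K ((1 : ℝ) • h)
  have e0 := change f K ((0 : ℝ) • h)
  have e00 : ∀ w : Phase d, kinMap (0, 0, 0) 1 1 w = w := fun w => by simp [kinMap_shift]
  rw [one_smul] at e1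
  rw [zero_smul] at e0
  simp only [e00] at e0
  rw [← e1, ← e0]
  have main := enorm_integral_path_sub_le (k := fun θ w => K (kinMap (0, -(θ • h), 0) 1 1 w))
    (k' := fun θ w => -_root_.fderiv ℝ K (kinMap (0, -(θ • h), 0) 1 1 w) (0, h, 0))
    (R := 3) (M := M) (D := (∑ i, C i : NNReal) *
      ∫⁻ w in Metric.closedBall 0 2, (‖G w‖ₑ + ‖S w‖ₑ)) hf.loc
    (fun θ => hK.1.continuous.comp (continuous_kinMap _ _ _))
    (fun θ => (hDK.1.continuous.comp (continuous_kinMap _ _ _)).neg) ?_ ?_ ?_ ?_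
  · simpa only [one_smul, zero_smul] using main
  · intro θ w
    have a1 : HasDerivAt (fun θ : ℝ => kinMap (0, -(θ • h), 0) 1 1 w) ((0, -h, 0) : Phase d) θ := by
      simp only [kinMap_shift]
      refine (hasDerivAt_const θ _).prodMk (HasDerivAt.prodMk ?_ (hasDerivAt_const θ _))
      simpa using (((hasDerivAt_id θ).smul_const h).neg.const_add w.2.1)
    have a2 := ((hK.1.differentiable (by simp) _).hasFDerivAt).comp_hasDerivAt θ a1
    have e : ((0, -h, 0) : Phase d) = -(0, h, 0) := by simp
    rw [e, map_neg] at a2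
    exact a2
  · intro θ _ w
    have := hM (kinMap (0, -(θ • h), 0) 1 1 w)
    rw [norm_neg]
    rwa [enorm_le_coe] at this
  · intro θ hθ w hw
    have : kinMap (0, -(θ • h), 0) 1 1 w ∉ Metric.closedBall (0 : Phase d) 1 := by
      contrapose! hw
      rw [mem_closedBall_zero_iff] at hw ⊢
      have e : w = kinMap (0, -(θ • h), 0) 1 1 w + (0, θ • h, 0) := by simp [kinMap_shift]
      have hn : ‖((0, θ • h, 0) : Phase d)‖ ≤ 2 := by
        rw [norm_shift, norm_smul]
        have : ‖θ‖ ≤ 2 := abs_le.2 ⟨by linarith [hθ.1], hθ.2.le⟩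
        simpa using mul_le_mul this hh (norm_nonneg _) (by norm_num)
      rw [e]
      exact (norm_add_le _ _).trans (by linarith)
    simp only [hK.eq_zero this, hDK.eq_zero this, neg_zero, and_self]
  · intro θ hθ
    simp only [mul_neg]
    rw [integral_neg, enorm_neg, change f (fun z => _root_.fderiv ℝ K z (0, h, 0)) (θ • h)]
    have hs := hf.comp_kinMap (0, θ • h, 0) one_pos one_pos
    simp only [map_x_eq_sum _ h, Finset.mul_sum]
    rw [integral_finsetSum, ENNReal.ofNNReal_finsetSum, Finset.sum_mul]
    · refine (enorm_sum_le _ _).trans (Finset.sum_le_sum fun i _ => ?_)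
      simp only [mul_left_comm _ (h i)]
      rw [integral_const_mul, enorm_mul]
      have hi : ‖h i‖ₑ ≤ 1 := by
        rw [← ENNReal.coe_one, enorm_le_coe]
        exact (PiLp.norm_apply_le h i).trans hh
      refine (mul_le_mul' hi (hC i _ _ _ hs)).trans ?_
      rw [one_mul]
      refine mul_le_mul_right ?_ _
      have hB : ∀ w ∈ Metric.closedBall (0 : Phase d) 1,
          kinMap (0, θ • h, 0) 1 1 w ∈ Metric.closedBall (0 : Phase d) 2 := by
        intro w hw
        rw [mem_closedBall_zero_iff] at hw ⊢
        have e : kinMap (0, θ • h, 0) 1 1 w = w + (0, θ • h, 0) := by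
          rw [kinMap_shift]; ext <;> simp
        have hn : ‖((0, θ • h, 0) : Phase d)‖ ≤ 1 := by
          rw [norm_shift, norm_smul]
          have : ‖θ‖ ≤ 1 := abs_le.2 ⟨by linarith [hθ.1], hθ.2⟩
          simpa using mul_le_mul this hh (norm_nonneg _) (by norm_num)
        rw [e]
        exact (norm_add_le _ _).trans (by linarith)
      have := setLIntegral_kinMap_le (0, θ • h, 0) one_pos one_pos hB
        fun w => ‖G w‖ₑ + ‖S w‖ₑ
      simpa [jac] using this
    · intro i _
      simp only [mul_left_comm _ (h i)]
      exact ((hK.derivX i).integrable_mul hs.loc).const_mul _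

/-! ### Kinetic averages and Young's inequality -/

/-- The integral of `g` over the kinetic ball `kinMap z T V (closedBall 0 R)`, normalised to unit
scale. -/
noncomputable def mass (R T V : ℝ) (g : Phase d → ℝ≥0∞) (z : Phase d) : ℝ≥0∞ :=
  ∫⁻ w in Metric.closedBall 0 R, g (kinMap z T V w)

lemma measurable_comp_kinMap {g : Phase d → ℝ≥0∞} (hg : Measurable g) (T V : ℝ) :
    Measurable fun x : Phase d × Phase d => g (kinMap x.1 T V x.2) :=
  hg.comp (continuous_kinMap_uncurry T V).measurable

lemma measurable_mass {g : Phase d → ℝ≥0∞} (hg : Measurable g) (R T V : ℝ) :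
    Measurable (mass R T V g) :=
  (measurable_comp_kinMap hg T V).lintegral_prod_right'

lemma mass_add {g g' : Phase d → ℝ≥0∞} (hg : Measurable g) (R T V : ℝ) (z : Phase d) :
    mass R T V (fun w => g w + g' w) z = mass R T V g z + mass R T V g' z :=
  lintegral_add_left (hg.comp (continuous_kinMap z T V).measurable) _

lemma mass_const_mul {g : Phase d → ℝ≥0∞} {c : ℝ≥0∞} (hc : c ≠ ⊤) (R T V : ℝ) (z : Phase d) :
    mass R T V (fun w => c * g w) z = c * mass R T V g z :=
  lintegral_const_mul' _ _ hc

lemma lintegral_mass {g : Phase d → ℝ≥0∞} (hg : Measurable g) (R T V : ℝ) :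
    ∫⁻ z, mass R T V g z = volume (Metric.closedBall (0 : Phase d) R) * ∫⁻ w, g w := by
  unfold mass
  rw [lintegral_lintegral_swap (measurable_comp_kinMap hg T V).aemeasurable]
  simp only [lintegral_kinMap_left hg]
  simp [mul_comm]

lemma mass_le {T V : ℝ} (hT : 0 < T) (hV : 0 < V) (R : ℝ) (g : Phase d → ℝ≥0∞) (z : Phase d) :
    mass R T V g z ≤ ENNReal.ofReal (jac d T V)⁻¹ * ∫⁻ w, g w := by
  rw [← lintegral_kinMap z hT hV]
  exact setLIntegral_le_lintegral _ _

lemma mass_rpow_le {p : ℝ} (hp : 1 < p) {g : Phase d → ℝ≥0∞} (hg : Measurable g) (R T V : ℝ)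
    (z : Phase d) :
    mass R T V g z ^ p ≤ volume (Metric.closedBall (0 : Phase d) R) ^ (p - 1) *
      mass R T V (fun w => g w ^ p) z := by
  have hc : p.HolderConjugate (Real.conjExponent p) := Real.HolderConjugate.conjExponent hp
  have h := ENNReal.lintegral_mul_le_Lp_mul_Lq (volume.restrict (Metric.closedBall (0 : Phase d) R))
    hc (f := fun w => g (kinMap z T V w)) (g := fun _ => 1)
    (hg.comp (continuous_kinMap z T V).measurable).aemeasurable aemeasurable_const
  simp only [Pi.mul_apply, mul_one, ENNReal.one_rpow, lintegral_const, one_mul,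
    Measure.restrict_apply_univ] at h
  have h2 := ENNReal.rpow_le_rpow h (by linarith : 0 ≤ p)
  refine h2.trans (le_of_eq ?_)
  rw [ENNReal.mul_rpow_of_nonneg _ _ (by linarith), ← ENNReal.rpow_mul, ← ENNReal.rpow_mul,
    one_div_mul_cancel (by linarith), ENNReal.rpow_one, mul_comm, mass]
  congr 2
  rw [Real.conjExponent]
  have : p - 1 ≠ 0 := by linarith
  field_simp

/-- Young's inequality on the Galilean group for the indicator of a kinetic ball. -/
lemma mass_young {p q : ℝ} (hp : 1 < p) (hpq : p ≤ q) (R : ℝ) :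
    ∃ C : NNReal, ∀ (T V : ℝ), 0 < T → 0 < V → ∀ g : Phase d → ℝ≥0∞, Measurable g →
      (∫⁻ z, mass R T V g z ^ q) ^ (1 / q) ≤
        C * (ENNReal.ofReal (jac d T V ^ (1 / q - 1 / p)) * (∫⁻ z, g z ^ p) ^ (1 / p)) := by
  set B := volume (Metric.closedBall (0 : Phase d) R) with hB
  have hBt : B ≠ ⊤ := measure_closedBall_lt_top.ne
  have hp0 : 0 < p := by linarith
  have hq0 : 0 < q := by linarith
  have hr : 0 ≤ q / p - 1 := by rw [sub_nonneg, le_div_iff₀ hp0]; linarith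
  have hqp : 0 ≤ q / p := by positivity
  set C : ℝ≥0∞ := ((B ^ (p - 1)) ^ (q / p) * B) ^ (1 / q) with hC
  have hCt : C ≠ ⊤ := by
    refine ENNReal.rpow_ne_top_of_nonneg (by positivity) (ENNReal.mul_ne_top ?_ hBt)
    exact ENNReal.rpow_ne_top_of_nonneg hqp (ENNReal.rpow_ne_top_of_nonneg (by linarith) hBt)
  refine ⟨C.toNNReal, fun T V hT hV g hg => ?_⟩
  rw [ENNReal.coe_toNNReal hCt]
  set I := ∫⁻ z, g z ^ p with hI
  set J := jac d T V with hJ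
  have hJ0 : 0 < J := jac_pos hT hV
  have hgp : Measurable fun z => g z ^ p := hg.pow_const p
  have hpt : ∀ z, mass R T V g z ^ q ≤
      (B ^ (p - 1)) ^ (q / p) * (ENNReal.ofReal J⁻¹ * I) ^ (q / p - 1) *
        mass R T V (fun w => g w ^ p) z := fun z => by
    have e : mass R T V g z ^ q = (mass R T V g z ^ p) ^ (q / p) := by
      rw [← ENNReal.rpow_mul]; congr 1; field_simp
    rw [e]
    refine (ENNReal.rpow_le_rpow (mass_rpow_le hp hg R T V z) hqp).trans ?_
    rw [ENNReal.mul_rpow_of_nonneg _ _ hqp, mul_assoc]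
    refine mul_le_mul_right ?_ _
    calc mass R T V (fun w => g w ^ p) z ^ (q / p)
        = mass R T V (fun w => g w ^ p) z ^ (q / p - 1) * mass R T V (fun w => g w ^ p) z := by
          conv_rhs => rw [← ENNReal.rpow_one (mass R T V (fun w => g w ^ p) z), ← ENNReal.rpow_mul,
            one_mul, ← ENNReal.rpow_add_of_nonneg _ _ hr zero_le_one]
          rw [sub_add_cancel]
      _ ≤ _ := by
          gcongr
          exact mass_le hT hV R _ z
  have hint : ∫⁻ z, mass R T V g z ^ q ≤
      ((B ^ (p - 1)) ^ (q / p) * B) * (ENNReal.ofReal J⁻¹ ^ (q / p - 1) * I ^ (q / p)) := by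
    refine (lintegral_mono hpt).trans (le_of_eq ?_)
    rw [lintegral_const_mul _ (measurable_mass hgp R T V), lintegral_mass hgp,
      ENNReal.mul_rpow_of_nonneg _ _ hr]
    have : I ^ (q / p) = I ^ (q / p - 1) * I := by
      conv_rhs => rw [← ENNReal.rpow_one I, ← ENNReal.rpow_mul, one_mul,
        ← ENNReal.rpow_add_of_nonneg _ _ hr zero_le_one]
      rw [sub_add_cancel]
    rw [this]
    ring
  refine (ENNReal.rpow_le_rpow hint (by positivity : 0 ≤ 1 / q)).trans (le_of_eq ?_)
  rw [ENNReal.mul_rpow_of_nonneg (_ * B) _ (by positivity), ← hC,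
    ENNReal.mul_rpow_of_nonneg _ _ (by positivity), ← ENNReal.rpow_mul, ← ENNReal.rpow_mul,
    ENNReal.ofReal_rpow_of_pos (by positivity),
    Real.inv_rpow hJ0.le, ← Real.rpow_neg hJ0.le]
  have e1 : -((q / p - 1) * (1 / q)) = 1 / q - 1 / p := by field_simp; ring
  have e2 : q / p * (1 / q) = 1 / p := by field_simp
  rw [e1, e2]

/-- The mollification of `f` at time scale `T` and velocity scale `V`, adapted to the Galilean
group. -/
noncomputable def moll (K : Phase d → ℝ) (T V : ℝ) (f : Phase d → ℝ) (z : Phase d) : ℝ :=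
  ∫ w, f (kinMap z T V w) * K w

lemma stronglyMeasurable_moll {K f : Phase d → ℝ} (hK : Continuous K) (hf : Measurable f)
    (T V : ℝ) : StronglyMeasurable (moll K T V f) :=
  StronglyMeasurable.integral_prod_right'
    (f := fun x : Phase d × Phase d => f (kinMap x.1 T V x.2) * K x.2)
    ((hf.comp (continuous_kinMap_uncurry T V).measurable).mul
      (hK.measurable.comp measurable_snd)).stronglyMeasurable

lemma moll_dil (K : Phase d → ℝ) (T V τ : ℝ) (f : Phase d → ℝ) (z : Phase d) :
    moll K (T * Real.exp (-τ)) (V * Real.exp (-(1 - τ))) f z =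
      ∫ w, f (kinMap z T V (dil τ 1 w)) * K w := by
  simp only [moll, dil, mul_one, kinMap_comp]

lemma moll_shift (K : Phase d → ℝ) {T V : ℝ} (hT : 0 < T) (hV : 0 < V) (f : Phase d → ℝ)
    (h : Sp d) (z : Phase d) :
    moll K T V f (z.1, z.2.1 + h, z.2.2) =
      ∫ w, f (kinMap z T V (kinMap (0, (T * V)⁻¹ • h, 0) 1 1 w)) * K w := by
  simp only [moll, kinMap_comp_shift, smul_smul, mul_inv_cancel₀ (mul_pos hT hV).ne', one_smul]

/-- A pointwise bound by masses of `‖G‖` and `‖S‖` yields an `L^q` bound, by Young's inequality. -/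
lemma eLpNorm_le_of_mass {p p' q : ℝ} (hp : 1 < p) (hp' : 1 < p') (hpq : p ≤ q) (hpq' : p' ≤ q)
    (R : ℝ) (C : NNReal) :
    ∃ C' : NNReal, ∀ (T V : ℝ), 0 < T → 0 < V → ∀ G S : Phase d → Sp d,
      Measurable G → Measurable S → ∀ u : Phase d → ℝ,
      (∀ z, ‖u z‖ₑ ≤ C * ∫⁻ w in Metric.closedBall 0 R,
        (‖V • G (kinMap z T V w)‖ₑ + ‖(T / V) • S (kinMap z T V w)‖ₑ)) →
      eLpNorm u (ENNReal.ofReal q) volume ≤ C' *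
        (ENNReal.ofReal (V * jac d T V ^ (1 / q - 1 / p)) * eLpNorm G (ENNReal.ofReal p) volume +
          ENNReal.ofReal (T / V * jac d T V ^ (1 / q - 1 / p')) *
            eLpNorm S (ENNReal.ofReal p') volume) := by
  obtain ⟨C₁, h₁⟩ := mass_young (d := d) hp hpq R
  obtain ⟨C₂, h₂⟩ := mass_young (d := d) hp' hpq' R
  refine ⟨C * (C₁ + C₂), fun T V hT hV G S hG hS u hu => ?_⟩
  have hq0 : 0 < q := by linarith
  have eN : ∀ {E : Type} [NormedAddCommGroup E] {r : ℝ} (_ : 0 < r) (F : Phase d → E),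
      eLpNorm F (ENNReal.ofReal r) volume = (∫⁻ z, ‖F z‖ₑ ^ r) ^ (1 / r) := fun hr F => by
    rw [eLpNorm_eq_lintegral_rpow_enorm_toReal (by simpa using hr) ENNReal.ofReal_ne_top,
      ENNReal.toReal_ofReal hr.le]
  have hu' : ∀ z, ‖u z‖ₑ ≤ C * (ENNReal.ofReal V * mass R T V (fun w => ‖G w‖ₑ) z +
      ENNReal.ofReal (T / V) * mass R T V (fun w => ‖S w‖ₑ) z) := fun z => by
    refine (hu z).trans (le_of_eq ?_)
    rw [← mass_const_mul ENNReal.ofReal_ne_top, ← mass_const_mul ENNReal.ofReal_ne_top,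
      ← mass_add (hG.enorm.const_mul _)]
    simp only [enorm_smul, Real.enorm_of_nonneg hV.le, Real.enorm_of_nonneg (div_pos hT hV).le]
    rfl
  have m1 := measurable_mass hG.enorm R T V
  have m2 := measurable_mass hS.enorm R T V
  have cst : ∀ (c : ℝ≥0∞) (g : Phase d → ℝ≥0∞), Measurable g →
      (∫⁻ z, (c * g z) ^ q) ^ (1 / q) = c * (∫⁻ z, g z ^ q) ^ (1 / q) := fun c g hg => by
    simp only [ENNReal.mul_rpow_of_nonneg _ _ hq0.le]
    rw [lintegral_const_mul _ (hg.pow_const q), ENNReal.mul_rpow_of_nonneg _ _ (by positivity),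
      ← ENNReal.rpow_mul, mul_one_div_cancel hq0.ne', ENNReal.rpow_one]
  rw [eN hq0, eN (by linarith), eN (by linarith)]
  calc (∫⁻ z, ‖u z‖ₑ ^ q) ^ (1 / q)
      ≤ (∫⁻ z, (C * (ENNReal.ofReal V * mass R T V (fun w => ‖G w‖ₑ) z +
          ENNReal.ofReal (T / V) * mass R T V (fun w => ‖S w‖ₑ) z)) ^ q) ^ (1 / q) := by
        gcongr with z
        exact hu' z
    _ = C * (∫⁻ z, (ENNReal.ofReal V * mass R T V (fun w => ‖G w‖ₑ) z +
          ENNReal.ofReal (T / V) * mass R T V (fun w => ‖S w‖ₑ) z) ^ q) ^ (1 / q) :=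
        cst _ _ ((m1.const_mul _).add (m2.const_mul _))
    _ ≤ C * (ENNReal.ofReal V * (∫⁻ z, mass R T V (fun w => ‖G w‖ₑ) z ^ q) ^ (1 / q) +
          ENNReal.ofReal (T / V) * (∫⁻ z, mass R T V (fun w => ‖S w‖ₑ) z ^ q) ^ (1 / q)) := by
        rw [← cst _ _ m1, ← cst _ _ m2]
        gcongr
        exact ENNReal.lintegral_Lp_add_le (m1.const_mul _).aemeasurable
          (m2.const_mul _).aemeasurable (by linarith)
    _ ≤ C * (ENNReal.ofReal V * (C₁ * (ENNReal.ofReal (jac d T V ^ (1 / q - 1 / p)) *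
            (∫⁻ z, ‖G z‖ₑ ^ p) ^ (1 / p))) +
          ENNReal.ofReal (T / V) * (C₂ * (ENNReal.ofReal (jac d T V ^ (1 / q - 1 / p')) *
            (∫⁻ z, ‖S z‖ₑ ^ p') ^ (1 / p')))) := by
        gcongr
        · exact h₁ T V hT hV _ hG.enorm
        · exact h₂ T V hT hV _ hS.enorm
    _ ≤ _ := by
        rw [ENNReal.ofReal_mul hV.le, ENNReal.ofReal_mul (div_pos hT hV).le, ENNReal.coe_mul,
          mul_assoc]
        refine mul_le_mul_right ?_ _
        rw [ENNReal.coe_add, mul_add]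
        refine add_le_add ?_ ?_
        · rw [mul_left_comm, mul_assoc]
          exact mul_le_mul_left le_self_add _
        · rw [mul_left_comm, mul_assoc]
          exact mul_le_mul_left le_add_self _

/-! ### Convergence of mollifications in `L²` -/

lemma integrable_moll {K f : Phase d → ℝ} (hK : IsTestIn 1 K) (hf : LocallyIntegrable f)
    {T V : ℝ} (hT : 0 < T) (hV : 0 < V) (z : Phase d) :
    Integrable fun w => f (kinMap z T V w) * K w :=
  hK.integrable_mul (locallyIntegrable_comp_kinMap hf z hT hV)

lemma moll_sub {K f g : Phase d → ℝ} (hK : IsTestIn 1 K) (hf : LocallyIntegrable f)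
    (hg : LocallyIntegrable g) {T V : ℝ} (hT : 0 < T) (hV : 0 < V) (z : Phase d) :
    moll K T V (f - g) z = moll K T V f z - moll K T V g z := by
  simp only [moll, Pi.sub_apply, sub_mul]
  exact integral_sub (integrable_moll hK hf hT hV z) (integrable_moll hK hg hT hV z)

lemma enorm_moll_le {K : Phase d → ℝ} {M : NNReal} (hK : IsTestIn 1 K) (hM : ∀ w, ‖K w‖ₑ ≤ M)
    (T V : ℝ) (f : Phase d → ℝ) (z : Phase d) :
    ‖moll K T V f z‖ₑ ≤ M * mass 1 T V (fun w => ‖f w‖ₑ) z := by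
  refine (enorm_integral_le_lintegral_enorm _).trans ?_
  rw [mass, ← lintegral_indicator Metric.isClosed_closedBall.measurableSet,
    ← lintegral_const_mul' _ _ ENNReal.coe_ne_top]
  refine lintegral_mono fun w => ?_
  by_cases hw : w ∈ Metric.closedBall 0 1
  · rw [Set.indicator_of_mem hw, enorm_mul, mul_comm]
    gcongr
    exact hM w
  · simp [hK.eq_zero hw]

lemma eLpNorm_two_moll_le {K : Phase d → ℝ} (hK : IsTestIn 1 K) :
    ∃ C : NNReal, ∀ T V : ℝ, 0 < T → 0 < V → ∀ f : Phase d → ℝ, Measurable f →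
      eLpNorm (moll K T V f) 2 volume ≤ C * eLpNorm f 2 volume := by
  obtain ⟨M, hM⟩ := hK.exists_bound
  obtain ⟨C, hC⟩ := mass_young (d := d) one_lt_two le_rfl 1
  refine ⟨M * C, fun T V hT hV f hf => ?_⟩
  rw [eLpNorm_eq_lintegral_rpow_enorm_toReal (by simp) (by simp),
    eLpNorm_eq_lintegral_rpow_enorm_toReal (by simp) (by simp)]
  simp only [ENNReal.toReal_ofNat]
  have h := hC T V hT hV _ hf.enorm
  rw [sub_self, Real.rpow_zero, ENNReal.ofReal_one, one_mul] at h
  calc (∫⁻ z, ‖moll K T V f z‖ₑ ^ (2 : ℝ)) ^ (1 / 2 : ℝ)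
      ≤ (∫⁻ z, (M * mass 1 T V (fun w => ‖f w‖ₑ) z) ^ (2 : ℝ)) ^ (1 / 2 : ℝ) := by
        gcongr with z
        exact enorm_moll_le hK hM T V f z
    _ = M * (∫⁻ z, mass 1 T V (fun w => ‖f w‖ₑ) z ^ (2 : ℝ)) ^ (1 / 2 : ℝ) := by
        simp only [ENNReal.mul_rpow_of_nonneg _ _ (zero_le_two : (0 : ℝ) ≤ 2)]
        rw [lintegral_const_mul _ ((measurable_mass hf.enorm 1 T V).pow_const _),
          ENNReal.mul_rpow_of_nonneg _ _ (by positivity), ← ENNReal.rpow_mul]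
        norm_num
    _ ≤ _ := by
        rw [ENNReal.coe_mul, mul_assoc]
        gcongr

/-- If `kinMap z T V w` lies in a ball, with `w` in the unit ball and scales at most one, then so
does `z`. -/
lemma norm_le_of_norm_kinMap_le {T V ρ : ℝ} (hT : 0 < T) (hV : 0 < V) (hT1 : T ≤ 1) (hV1 : V ≤ 1)
    {z w : Phase d} (hw : ‖w‖ ≤ 1) (h : ‖kinMap z T V w‖ ≤ ρ) : ‖z‖ ≤ 2 * ρ + 2 := by
  have hρ : 0 ≤ ρ := (norm_nonneg _).trans h
  have w1 : ‖w.1‖ ≤ 1 := (norm_fst_le w).trans hw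
  have w2 : ‖w.2.1‖ ≤ 1 := ((norm_fst_le w.2).trans (norm_snd_le w)).trans hw
  have w3 : ‖w.2.2‖ ≤ 1 := ((norm_snd_le w.2).trans (norm_snd_le w)).trans hw
  rw [kinMap_apply] at h
  have u1 := (norm_fst_le _).trans h
  have u2 := ((norm_fst_le _).trans (norm_snd_le _)).trans h
  have u3 := ((norm_snd_le _).trans (norm_snd_le _)).trans h
  simp only at u1 u2 u3
  have a1 : ‖T * w.1‖ ≤ 1 := by
    rw [norm_mul, Real.norm_of_nonneg hT.le]; exact mul_le_one₀ hT1 (norm_nonneg _) w1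
  have a2 : ‖(T * V) • w.2.1‖ ≤ 1 := by
    rw [norm_smul, Real.norm_of_nonneg (mul_pos hT hV).le]
    exact mul_le_one₀ (mul_le_one₀ hT1 hV.le hV1) (norm_nonneg _) w2
  have a3 : ‖V • w.2.2‖ ≤ 1 := by
    rw [norm_smul, Real.norm_of_nonneg hV.le]; exact mul_le_one₀ hV1 (norm_nonneg _) w3
  have z1 : ‖z.1‖ ≤ ρ + 1 := by
    have := norm_sub_le (z.1 + T * w.1) (T * w.1)
    rw [add_sub_cancel_right] at this; linarith
  have z3 : ‖z.2.2‖ ≤ ρ + 1 := by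
    have := norm_sub_le (z.2.2 + V • w.2.2) (V • w.2.2)
    rw [add_sub_cancel_right] at this; linarith
  have a4 : ‖(T * w.1) • z.2.2‖ ≤ ρ + 1 := by
    rw [norm_smul]
    nlinarith [norm_nonneg (T * w.1), norm_nonneg z.2.2]
  have z2 : ‖z.2.1‖ ≤ 2 * ρ + 2 := by
    have e : z.2.1 = (z.2.1 + (T * V) • w.2.1 + (T * w.1) • z.2.2) -
      ((T * V) • w.2.1 + (T * w.1) • z.2.2) := by abel
    have b2 := norm_add_le ((T * V) • w.2.1) ((T * w.1) • z.2.2)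
    rw [e]
    refine (norm_sub_le _ _).trans ?_
    linarith
  rw [Prod.norm_def, Prod.norm_def]
  exact max_le (by linarith) (max_le z2 (by linarith))

lemma tendsto_eLpNorm_moll_sub_of_continuous {K : Phase d → ℝ} (hK : IsTestIn 1 K)
    (hK1 : ∫ w, K w = 1) {g : Phase d → ℝ} (hg : Continuous g) (hgc : HasCompactSupport g)
    {T V : ℕ → ℝ} (hT : ∀ n, 0 < T n) (hV : ∀ n, 0 < V n)
    (hTl : Filter.Tendsto T Filter.atTop (nhds 0)) (hVl : Filter.Tendsto V Filter.atTop (nhds 0)) :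
    Filter.Tendsto (fun n => eLpNorm (moll K (T n) (V n) g - g) 2 volume) Filter.atTop
      (nhds 0) := by
  obtain ⟨B, hB⟩ := hg.bounded_above_of_compact_support hgc
  have hKi : Integrable K := hK.1.continuous.integrable_of_hasCompactSupport hK.hasCompactSupport
  have hpt : ∀ z, Filter.Tendsto (fun n => moll K (T n) (V n) g z) Filter.atTop (nhds (g z)) := by
    intro z
    have : g z = ∫ w, g z * K w := by rw [integral_const_mul, hK1, mul_one]
    rw [this]
    refine tendsto_integral_of_dominated_convergence (fun w => B * ‖K w‖) (fun n =>
      ((hg.comp (continuous_kinMap z _ _)).mul hK.1.continuous).aestronglyMeasurable)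
      (hKi.norm.const_mul B) (fun n => Filter.Eventually.of_forall fun w => ?_)
      (Filter.Eventually.of_forall fun w => ?_)
    · rw [norm_mul]
      exact mul_le_mul_of_nonneg_right (hB _) (norm_nonneg _)
    · refine Filter.Tendsto.mul_const _ ((hg.tendsto z).comp ?_)
      have h1 : Filter.Tendsto (fun n => ((z.1 + T n * w.1,
          z.2.1 + (T n * V n) • w.2.1 + (T n * w.1) • z.2.2, z.2.2 + V n • w.2.2) : Phase d))
          Filter.atTop (nhds (z.1 + 0 * w.1,
            z.2.1 + ((0 : ℝ) * 0) • w.2.1 + ((0 : ℝ) * w.1) • z.2.2, z.2.2 + (0 : ℝ) • w.2.2)) :=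
        ((hTl.mul_const _).const_add _).prodMk_nhds
          (((((hTl.mul hVl).smul_const _).const_add _).add
            ((hTl.mul_const _).smul_const _)).prodMk_nhds ((hVl.smul_const _).const_add _))
      simpa [kinMap_apply] using h1
  obtain ⟨M, hM⟩ := hK.exists_bound
  obtain ⟨ρ, hρ⟩ := hgc.isCompact.isBounded.subset_closedBall (0 : Phase d)
  set L : ℝ := ∫ w, B * ‖K w‖ with hL
  have hbd : ∀ n z, ‖moll K (T n) (V n) g z‖ ≤ L := fun n z => by
    refine norm_integral_le_of_norm_le (hKi.norm.const_mul B) (Filter.Eventually.of_forall ?_)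
    intro w
    rw [norm_mul]
    exact mul_le_mul_of_nonneg_right (hB _) (norm_nonneg _)
  set ρ' : ℝ := 2 * max ρ 0 + 2 with hρ'
  have hout : ∀ n, T n ≤ 1 → V n ≤ 1 → ∀ z, z ∉ Metric.closedBall 0 ρ' →
      moll K (T n) (V n) g z - g z = 0 := by
    intro n h1 h2 z hz
    have gz : g z = 0 := by
      refine image_eq_zero_of_notMem_tsupport fun h => hz ?_
      have := hρ h
      rw [mem_closedBall_zero_iff] at this ⊢
      have := le_max_left ρ 0
      have := le_max_right ρ 0
      linarith
    have mz : moll K (T n) (V n) g z = 0 := by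
      refine integral_eq_zero_of_ae (Filter.Eventually.of_forall fun w => ?_)
      by_cases hw : w ∈ Metric.closedBall (0 : Phase d) 1
      · have : g (kinMap z (T n) (V n) w) = 0 := by
          refine image_eq_zero_of_notMem_tsupport fun h => hz ?_
          have h' := hρ h
          rw [mem_closedBall_zero_iff] at h' hw ⊢
          exact norm_le_of_norm_kinMap_le (hT n) (hV n) h1 h2 hw (h'.trans (le_max_left ρ 0))
        simp [this]
      · simp [hK.eq_zero hw]
    rw [gz, mz, sub_zero]
  have hlim : Filter.Tendsto (fun n => ∫⁻ z, ‖moll K (T n) (V n) g z - g z‖ₑ ^ (2 : ℝ))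
      Filter.atTop (nhds (∫⁻ _ : Phase d, 0)) := by
    refine tendsto_lintegral_filter_of_dominated_convergence
      ((Metric.closedBall (0 : Phase d) ρ').indicator fun _ => ENNReal.ofReal (L + B) ^ (2 : ℝ))
      (Filter.Eventually.of_forall fun n =>
        (((stronglyMeasurable_moll hK.1.continuous hg.measurable _ _).measurable.sub
          hg.measurable).enorm.pow_const _)) ?_ ?_ ?_
    · filter_upwards [hTl.eventually_le_const one_pos, hVl.eventually_le_const one_pos]
        with n h1 h2
      refine Filter.Eventually.of_forall fun z => ?_
      by_cases hz : z ∈ Metric.closedBall (0 : Phase d) ρ'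
      · rw [Set.indicator_of_mem hz, ← ofReal_norm]
        gcongr
        exact (norm_sub_le _ _).trans (add_le_add (hbd n z) (hB z))
      · rw [hout n h1 h2 z hz]; simp
    · rw [lintegral_indicator Metric.isClosed_closedBall.measurableSet, lintegral_const]
      refine ENNReal.mul_ne_top (ENNReal.rpow_ne_top_of_nonneg (by norm_num) ENNReal.ofReal_ne_top)
        ?_
      rw [Measure.restrict_apply_univ]
      exact measure_closedBall_lt_top.ne
    · refine Filter.Eventually.of_forall fun z => ?_
      have h1 : Filter.Tendsto (fun n => moll K (T n) (V n) g z - g z) Filter.atTop (nhds 0) := by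
        simpa using (hpt z).sub_const (g z)
      have h2 := (ENNReal.continuous_rpow_const (y := 2)).tendsto _ |>.comp
        ((continuous_enorm.tendsto (0 : ℝ)).comp h1)
      simpa [Function.comp_def] using h2
  simp only [eLpNorm_eq_lintegral_rpow_enorm_toReal (p := 2) (by simp) (by simp),
    ENNReal.toReal_ofNat, Pi.sub_apply]
  have h3 := (ENNReal.continuous_rpow_const (y := (1 / 2 : ℝ))).tendsto _ |>.comp hlim
  simpa [Function.comp_def] using h3

/-- Mollifications converge in `L²` as both scales tend to zero. -/
lemma tendsto_eLpNorm_moll_sub {K : Phase d → ℝ} (hK : IsTestIn 1 K)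
    (hK1 : ∫ w, K w = 1) {f : Phase d → ℝ} (hfm : Measurable f) (hf : MemLp f 2 volume)
    {T V : ℕ → ℝ} (hT : ∀ n, 0 < T n) (hV : ∀ n, 0 < V n)
    (hTl : Filter.Tendsto T Filter.atTop (nhds 0)) (hVl : Filter.Tendsto V Filter.atTop (nhds 0)) :
    Filter.Tendsto (fun n => eLpNorm (moll K (T n) (V n) f - f) 2 volume) Filter.atTop
      (nhds 0) := by
  obtain ⟨C, hC⟩ := eLpNorm_two_moll_le hK
  rw [ENNReal.tendsto_nhds_zero]
  intro ε hε
  rcases eq_or_ne ε ⊤ with rfl | hεt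
  · simp
  set δ : ℝ≥0∞ := ε / (2 * (C + 1)) with hδ
  have hC1 : (2 * (C + 1) : ℝ≥0∞) ≠ ⊤ := by finiteness
  have hδ0 : δ ≠ 0 := (ENNReal.div_pos hε.ne' hC1).ne'
  obtain ⟨g, hgc, hfg, hg, hgL⟩ := hf.exists_hasCompactSupport_eLpNorm_sub_le (by simp) hδ0
  have hlf := hf.locallyIntegrable one_le_two
  have hlg := hgL.locallyIntegrable one_le_two
  have hgl := tendsto_eLpNorm_moll_sub_of_continuous hK hK1 hg hgc hT hV hTl hVl
  filter_upwards [ENNReal.tendsto_nhds_zero.1 hgl (ε / 2) (ENNReal.half_pos hε.ne')] with n hn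
  have e : moll K (T n) (V n) f - f =
      (moll K (T n) (V n) (f - g) + (moll K (T n) (V n) g - g)) - (f - g) := by
    ext z
    simp only [Pi.sub_apply, Pi.add_apply, moll_sub hK hlf hlg (hT n) (hV n)]
    ring
  have m1 : AEStronglyMeasurable (moll K (T n) (V n) (f - g)) volume :=
    (stronglyMeasurable_moll hK.1.continuous (hfm.sub hg.measurable) _ _).aestronglyMeasurable
  have m2 : AEStronglyMeasurable (moll K (T n) (V n) g - g) volume :=
    ((stronglyMeasurable_moll hK.1.continuous hg.measurable _ _).sub
      hg.stronglyMeasurable).aestronglyMeasurable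
  have m3 : AEStronglyMeasurable (f - g) volume :=
    (hfm.sub hg.measurable).aestronglyMeasurable
  rw [e]
  calc eLpNorm ((moll K (T n) (V n) (f - g) + (moll K (T n) (V n) g - g)) - (f - g)) 2 volume
      ≤ eLpNorm (moll K (T n) (V n) (f - g)) 2 volume +
          eLpNorm (moll K (T n) (V n) g - g) 2 volume + eLpNorm (f - g) 2 volume :=
        (eLpNorm_sub_le (m1.add m2) m3 one_le_two).trans
          (add_le_add_left (eLpNorm_add_le m1 m2 one_le_two) _)
    _ ≤ C * δ + ε / 2 + δ := by
        gcongr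
        exact (hC _ _ (hT n) (hV n) _ (hfm.sub hg.measurable)).trans (mul_le_mul_right hfg _)
    _ = (C + 1) * δ + ε / 2 := by ring
    _ = ε / 2 + ε / 2 := by
        congr 1
        rw [hδ, ENNReal.div_eq_inv_mul, ENNReal.mul_inv (by simp) (by simp), ENNReal.div_eq_inv_mul,
          mul_comm (2⁻¹ : ℝ≥0∞), mul_assoc, ← mul_assoc (C + 1 : ℝ≥0∞),
          ENNReal.mul_inv_cancel (by simp) (by finiteness), one_mul]
    _ = ε := ENNReal.add_halves ε

/-! ### Scaling and summation over scales -/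

/-- The four exponent identities express that the two terms of the one-scale estimate scale like
the claimed bound `y^s A^α B^{1-α}`. -/
lemma scaling_exponents {d p p' q D : ℝ} (hp : 1 < p) (hq : 0 < q)
    (hD : D = d * (p - 2) + 2 * p + 2) (h0 : 0 < D) {τ κ s α : ℝ}
    (hτ : τ = (2 * p - 4 * d + 2 * d * p) / D) (hκ : κ = p / D) (hp' : p' = p / (p - 1))
    (hs : s = (p * (4 * d + 2) - q * d * (p + 2)) / (q * D))
    (hα : α = (q * (p * (1 + d) - d + 1) - (d - 1) * p) / (q * D)) :
    (1 - τ) + (1 / q - 1 / p) * (τ + d + (1 - τ) * d) = s ∧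
    (2 * τ - 1) + (1 / q - 1 / p') * (τ + d + (1 - τ) * d) = s ∧
    -κ + (1 / q - 1 / p) * κ * (1 - d) + 1 = α ∧
    2 * κ + (1 / q - 1 / p') * κ * (1 - d) = α := by
  have h1 : p - 1 ≠ 0 := by linarith
  subst hτ hκ hp' hs hα
  refine ⟨?_, ?_, ?_, ?_⟩ <;> field_simp <;> subst hD <;> ring

/-- With time scale `(A/B)^κ y^τ` and velocity scale `(A/B)^{-κ} y^{1-τ}`, hence position scale
`y`, both terms of the one-scale estimate are equal to `y^s A^α B^{1-α}`. -/
lemma balanced_scales {p p' q τ κ s α A B y : ℝ} (hA : 0 < A) (hB : 0 < B) (hy : 0 < y)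
    (h1 : (1 - τ) + (1 / q - 1 / p) * (τ + d + (1 - τ) * d) = s)
    (h2 : (2 * τ - 1) + (1 / q - 1 / p') * (τ + d + (1 - τ) * d) = s)
    (h3 : -κ + (1 / q - 1 / p) * κ * (1 - d) + 1 = α)
    (h4 : 2 * κ + (1 / q - 1 / p') * κ * (1 - d) = α) {T V : ℝ}
    (hT : T = (A / B) ^ κ * y ^ τ) (hV : V = (A / B) ^ (-κ) * y ^ (1 - τ)) :
    V * jac d T V ^ (1 / q - 1 / p) * A = y ^ s * (A ^ α * B ^ (1 - α)) ∧
    T / V * jac d T V ^ (1 / q - 1 / p') * B = y ^ s * (A ^ α * B ^ (1 - α)) := by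
  obtain ⟨a, rfl⟩ : ∃ a, A = Real.exp a := ⟨Real.log A, (Real.exp_log hA).symm⟩
  obtain ⟨b, rfl⟩ : ∃ b, B = Real.exp b := ⟨Real.log B, (Real.exp_log hB).symm⟩
  obtain ⟨Y, rfl⟩ : ∃ Y, y = Real.exp Y := ⟨Real.log y, (Real.exp_log hy).symm⟩
  subst hT hV
  simp only [jac, ← Real.exp_sub, ← Real.exp_mul, ← Real.exp_add, ← Real.exp_nat_mul]
  refine ⟨congrArg Real.exp ?_, congrArg Real.exp ?_⟩
  · linear_combination Y * h1 + (a - b) * h3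
  · linear_combination Y * h2 + (a - b) * h4

lemma measurePreserving_shift (h : Sp d) :
    MeasurePreserving (fun z : Phase d => (z.1, z.2.1 + h, z.2.2)) volume volume := by
  have e : (fun z : Phase d => (z.1, z.2.1 + h, z.2.2)) = fun z => z + (0, h, 0) := by
    ext z <;> simp
  rw [e]
  exact measurePreserving_add_right volume _

lemma aestronglyMeasurable_diffX {u : Phase d → ℝ} (hu : AEStronglyMeasurable u volume)
    (h : Sp d) : AEStronglyMeasurable (diffX h u) volume :=
  (hu.comp_measurePreserving (measurePreserving_shift h)).sub hu

lemma eLpNorm_diffX_le_two_mul {u : Phase d → ℝ} (hu : AEStronglyMeasurable u volume) (h : Sp d)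
    {q : ℝ≥0∞} (hq : 1 ≤ q) : eLpNorm (diffX h u) q volume ≤ 2 * eLpNorm u q volume := by
  have mp := measurePreserving_shift h
  rw [two_mul]
  refine (eLpNorm_sub_le (hu.comp_measurePreserving mp) hu hq).trans ?_
  rw [eLpNorm_comp_measurePreserving hu mp]

lemma tendsto_diffX {u : ℕ → Phase d → ℝ} {f : Phase d → ℝ} (h : Sp d)
    (hu : ∀ᵐ z, Filter.Tendsto (fun n => u n z) Filter.atTop (nhds (f z))) :
    ∀ᵐ z, Filter.Tendsto (fun n => diffX h (u n) z) Filter.atTop (nhds (diffX h f z)) := by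
  filter_upwards [hu, (measurePreserving_shift h).quasiMeasurePreserving.ae hu] with z h1 h2
  exact h2.sub h1

/-- The finite-difference estimate for measurable representatives, with strictly positive upper
bounds `A`, `B` for the two norms. -/
lemma exists_eLpNorm_diffX_le {p p' q τ κ s α : ℝ} (hp : 1 < p) (hp' : 1 < p') (hpq : p ≤ q)
    (hpq' : p' ≤ q) (hτ : 0 < τ) (hτ' : τ < 1) (hs : 0 < s)
    (h1 : (1 - τ) + (1 / q - 1 / p) * (τ + d + (1 - τ) * d) = s)
    (h2 : (2 * τ - 1) + (1 / q - 1 / p') * (τ + d + (1 - τ) * d) = s)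
    (h3 : -κ + (1 / q - 1 / p) * κ * (1 - d) + 1 = α)
    (h4 : 2 * κ + (1 / q - 1 / p') * κ * (1 - d) = α) :
    ∃ C : NNReal, ∀ (f : Phase d → ℝ) (G S : Phase d → Sp d), Measurable f → Measurable G →
      Measurable S → MemLp f 2 volume → IsSol f G S → ∀ A B : ℝ, 0 < A → 0 < B →
      eLpNorm G (ENNReal.ofReal p) volume ≤ ENNReal.ofReal A →
      eLpNorm S (ENNReal.ofReal p') volume ≤ ENNReal.ofReal B → ∀ h : Sp d, h ≠ 0 →
      eLpNorm (diffX h f) (ENNReal.ofReal q) volume ≤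
        C * ENNReal.ofReal (‖h‖ ^ s * (A ^ α * B ^ (1 - α))) := by
  let bump : ContDiffBump (0 : Phase d) := ⟨1 / 2, 1, by norm_num, by norm_num⟩
  set K : Phase d → ℝ := bump.normed volume with hKdef
  have hK1 : ∫ w, K w = 1 := bump.integral_normed
  have hK : IsTestIn 1 K := ⟨bump.contDiff_normed, by rw [hKdef, bump.tsupport_normed_eq]⟩
  obtain ⟨C₁, hC₁⟩ := hK.dil_sub_controlled hτ.le hτ'.le
  obtain ⟨C₂, hC₂⟩ := hK.shift_sub_controlled
  obtain ⟨D₁, hD₁⟩ := eLpNorm_le_of_mass (d := d) hp hp' hpq hpq' 1 C₁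
  obtain ⟨D₂, hD₂⟩ := eLpNorm_le_of_mass (d := d) hp hp' hpq hpq' 2 C₂
  have hq1 : 1 ≤ ENNReal.ofReal q := by
    rw [← ENNReal.ofReal_one]; exact ENNReal.ofReal_le_ofReal (by linarith)
  set r : ℝ := Real.exp (-s) with hr
  have hr1 : ENNReal.ofReal r < 1 := by
    rw [← ENNReal.ofReal_one]
    exact (ENNReal.ofReal_lt_ofReal_iff one_pos).2 (Real.exp_lt_one_iff.2 (by linarith))
  set Z : ℝ≥0∞ := (1 - ENNReal.ofReal r)⁻¹ with hZ
  have hZt : Z ≠ ⊤ := ENNReal.inv_ne_top.2 (tsub_pos_iff_lt.2 hr1).ne'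
  refine ⟨4 * D₁ * Z.toNNReal + 2 * D₂, fun f G S hfm hGm hSm hf hsol A B hA hB hGA hSB h hh => ?_⟩
  set N : ℝ := A ^ α * B ^ (1 - α) with hN
  have hN0 : 0 < N := mul_pos (Real.rpow_pos_of_pos hA _) (Real.rpow_pos_of_pos hB _)
  have hAB : 0 < A / B := div_pos hA hB
  -- The powers of `A / B` equalise the contributions of `∇_v f` and of the source.
  set T : ℝ → ℝ := fun y => (A / B) ^ κ * y ^ τ with hT
  set V : ℝ → ℝ := fun y => (A / B) ^ (-κ) * y ^ (1 - τ) with hV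
  have hT0 : ∀ y, 0 < y → 0 < T y := fun y hy =>
    mul_pos (Real.rpow_pos_of_pos hAB _) (Real.rpow_pos_of_pos hy _)
  have hV0 : ∀ y, 0 < y → 0 < V y := fun y hy =>
    mul_pos (Real.rpow_pos_of_pos hAB _) (Real.rpow_pos_of_pos hy _)
  have hTV : ∀ y, 0 < y → T y * V y = y := fun y hy => by
    rw [hT, hV]
    calc (A / B) ^ κ * y ^ τ * ((A / B) ^ (-κ) * y ^ (1 - τ))
        = ((A / B) ^ κ * (A / B) ^ (-κ)) * (y ^ τ * y ^ (1 - τ)) := by ring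
      _ = y := by
        rw [← Real.rpow_add hAB, ← Real.rpow_add hy]; simp
  -- The right-hand side of the one-scale estimate at position scale `y`.
  have hscale : ∀ y, 0 < y →
      ENNReal.ofReal (V y * jac d (T y) (V y) ^ (1 / q - 1 / p)) *
          eLpNorm G (ENNReal.ofReal p) volume +
        ENNReal.ofReal (T y / V y * jac d (T y) (V y) ^ (1 / q - 1 / p')) *
          eLpNorm S (ENNReal.ofReal p') volume ≤ 2 * ENNReal.ofReal (y ^ s * N) := fun y hy => by
    obtain ⟨e1, e2⟩ := balanced_scales (d := d) hA hB hy h1 h2 h3 h4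
      (T := T y) (V := V y) rfl rfl
    have hJ := jac_pos (d := d) (hT0 y hy) (hV0 y hy)
    have hTy := hT0 y hy
    have hVy := hV0 y hy
    rw [two_mul]
    refine add_le_add ?_ ?_
    · rw [← e1, ENNReal.ofReal_mul (q := A) (by positivity)]
      exact mul_le_mul_right hGA _
    · rw [← e2, ENNReal.ofReal_mul (q := B) (by positivity)]
      exact mul_le_mul_right hSB _
  have hy : 0 < ‖h‖ := norm_pos_iff.2 hh
  set y : ℕ → ℝ := fun n => ‖h‖ * Real.exp (-1) ^ n with hydef
  have hy0 : ∀ n, 0 < y n := fun n => by positivity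
  have hys : ∀ (c : ℝ) n, y n ^ c = ‖h‖ ^ c * Real.exp (-c) ^ n := fun c n => by
    rw [hydef, Real.mul_rpow hy.le (by positivity), ← Real.exp_nat_mul, ← Real.exp_nat_mul,
      ← Real.exp_mul]
    congr 2; ring
  have htend : ∀ c : ℝ, 0 < c → Filter.Tendsto (fun n => y n ^ c) Filter.atTop (nhds 0) :=
    fun c hc => by
      simp only [hys]
      simpa using (tendsto_pow_atTop_nhds_zero_of_lt_one (Real.exp_pos _).le
        (Real.exp_lt_one_iff.2 (by linarith : -c < 0))).const_mul (‖h‖ ^ c)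
  have hTl : Filter.Tendsto (fun n => T (y n)) Filter.atTop (nhds 0) := by
    simpa using (htend τ hτ).const_mul ((A / B) ^ κ)
  have hVl : Filter.Tendsto (fun n => V (y n)) Filter.atTop (nhds 0) := by
    simpa using (htend (1 - τ) (by linarith)).const_mul ((A / B) ^ (-κ))
  set F : ℕ → Phase d → ℝ := fun n => moll K (T (y n)) (V (y n)) f with hF
  have hFm : ∀ n, AEStronglyMeasurable (F n) volume := fun n =>
    (stronglyMeasurable_moll hK.1.continuous hfm _ _).aestronglyMeasurable
  have hTs : ∀ n, T (y (n + 1)) = T (y n) * Real.exp (-τ) := fun n => by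
    simp only [hT, hys, pow_succ]; ring
  have hVs : ∀ n, V (y (n + 1)) = V (y n) * Real.exp (-(1 - τ)) := fun n => by
    simp only [hV, hys, pow_succ]; ring
  -- Passing from one scale to the next; the bounds form a geometric series because `s > 0`.
  have hstep : ∀ n, eLpNorm (F (n + 1) - F n) (ENNReal.ofReal q) volume ≤
      2 * D₁ * ENNReal.ofReal (‖h‖ ^ s * N) * ENNReal.ofReal r ^ n := fun n => by
    have hb := hD₁ (T (y n)) (V (y n)) (hT0 _ (hy0 n)) (hV0 _ (hy0 n)) G S hGm hSm
      (F (n + 1) - F n) fun z => by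
        have := hC₁ _ _ _ (hsol.comp_kinMap z (hT0 _ (hy0 n)) (hV0 _ (hy0 n)))
        rw [← moll_dil, ← hTs, ← hVs] at this
        exact this
    refine hb.trans ((mul_le_mul_right (hscale _ (hy0 n)) _).trans (le_of_eq ?_))
    rw [hys, ← hr, ← ENNReal.ofReal_pow (Real.exp_pos _).le, mul_assoc (2 * (D₁ : ℝ≥0∞)),
      ← ENNReal.ofReal_mul (by positivity), mul_right_comm (‖h‖ ^ s) (r ^ n) N]
    ring
  have hsum : ∀ n, eLpNorm (F n - F 0) (ENNReal.ofReal q) volume ≤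
      2 * D₁ * ENNReal.ofReal (‖h‖ ^ s * N) * Z := fun n => by
    rw [← Finset.sum_range_sub F n]
    refine (eLpNorm_sum_le (fun i _ => (hFm _).sub (hFm _)) hq1).trans ?_
    refine (Finset.sum_le_sum fun i _ => hstep i).trans ?_
    rw [← Finset.mul_sum, hZ, ← ENNReal.tsum_geometric]
    exact mul_le_mul_right (ENNReal.sum_le_tsum _) _
  -- At position scale `‖h‖` the shift by `h` is a unit shift of the mollifier.
  have hbase : eLpNorm (diffX h (F 0)) (ENNReal.ofReal q) volume ≤
      2 * D₂ * ENNReal.ofReal (‖h‖ ^ s * N) := by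
    have hy00 : y 0 = ‖h‖ := by simp [hydef]
    have hb := hD₂ (T ‖h‖) (V ‖h‖) (hT0 _ hy) (hV0 _ hy) G S hGm hSm (diffX h (F 0)) fun z => by
        have hle : ‖(T ‖h‖ * V ‖h‖)⁻¹ • h‖ ≤ 1 := by
          rw [hTV _ hy, norm_smul, norm_inv, norm_norm, inv_mul_cancel₀ hy.ne']
        have := hC₂ _ hle _ _ _ (hsol.comp_kinMap z (hT0 _ hy) (hV0 _ hy))
        rw [← moll_shift K (hT0 _ hy) (hV0 _ hy)] at this
        simp only [diffX, hF, hy00]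
        exact this
    refine hb.trans ((mul_le_mul_right (hscale _ hy) _).trans (le_of_eq ?_))
    ring
  have hall : ∀ n, eLpNorm (diffX h (F n)) (ENNReal.ofReal q) volume ≤
      (4 * D₁ * Z.toNNReal + 2 * D₂ : NNReal) * ENNReal.ofReal (‖h‖ ^ s * N) := fun n => by
    have e : diffX h (F n) = diffX h (F n - F 0) + diffX h (F 0) := by
      ext z; simp [diffX]; ring
    rw [e]
    refine (eLpNorm_add_le (aestronglyMeasurable_diffX ((hFm n).sub (hFm 0)) h)
      (aestronglyMeasurable_diffX (hFm 0) h) hq1).trans ?_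
    refine (add_le_add ((eLpNorm_diffX_le_two_mul ((hFm n).sub (hFm 0)) h hq1).trans
      (mul_le_mul_right (hsum n) 2)) hbase).trans (le_of_eq ?_)
    push_cast
    rw [ENNReal.coe_toNNReal hZt]
    ring
  have hL2 := tendsto_eLpNorm_moll_sub hK hK1 hfm hf (fun n => hT0 _ (hy0 n))
    (fun n => hV0 _ (hy0 n)) hTl hVl
  obtain ⟨ns, -, hns⟩ := (tendstoInMeasure_of_tendsto_eLpNorm (p := 2) (by simp) hFm
    hf.aestronglyMeasurable hL2).exists_seq_tendsto_ae
  refine (Lp.eLpNorm_lim_le_liminf_eLpNorm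
    (fun n => aestronglyMeasurable_diffX (hFm (ns n)) h) _ (tendsto_diffX h hns)).trans ?_
  exact Filter.liminf_le_of_le (by isBoundedDefault) fun b hb => by
    obtain ⟨n, hn⟩ := hb.exists
    exact hn.trans (hall (ns n))

lemma IsSol.congr {f f' : Phase d → ℝ} {G G' S S' : Phase d → Sp d} (h : IsSol f G S)
    (hf : f =ᵐ[volume] f') (hG : G =ᵐ[volume] G') (hS : S =ᵐ[volume] S') : IsSol f' G' S' where
  loc := h.loc.congr hf
  locG := h.locG.congr hG
  locS := h.locS.congr hS
  grad φ hφ i := by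
    have e1 : ∫ z, f' z * gradV φ z i = ∫ z, f z * gradV φ z i :=
      integral_congr_ae (by filter_upwards [hf] with z hz; rw [hz])
    have e2 : ∫ z, G' z i * φ z = ∫ z, G z i * φ z :=
      integral_congr_ae (by filter_upwards [hG] with z hz; rw [hz])
    rw [e1, e2, h.grad φ hφ i]
  eq φ hφ := by
    have e1 : ∫ z, f' z * transport φ z = ∫ z, f z * transport φ z :=
      integral_congr_ae (by filter_upwards [hf] with z hz; rw [hz])
    have e2 : ∫ z, inner ℝ (S' z) (gradV φ z) = ∫ z, inner ℝ (S z) (gradV φ z) :=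
      integral_congr_ae (by filter_upwards [hS] with z hz; rw [hz])
    rw [e1, e2, h.eq φ hφ]

lemma diffX_congr {f f' : Phase d → ℝ} (hf : f =ᵐ[volume] f') (h : Sp d) :
    diffX h f =ᵐ[volume] diffX h f' := by
  filter_upwards [hf, (measurePreserving_shift h).quasiMeasurePreserving.ae hf] with z h1 h2
  rw [diffX, diffX, h1, h2]

/-! ### The Besov estimate -/

/-- The Besov bound for all admissible data. Approximating the two norms from above by positive
numbers covers the case in which one of them vanishes. -/
lemma exists_besovX_le {p p' q τ κ s α : ℝ} (hp : 1 < p) (hp' : 1 < p') (hpq : p ≤ q)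
    (hpq' : p' ≤ q) (hτ : 0 < τ) (hτ' : τ < 1) (hs : 0 < s) (hα : 0 < α) (hα' : α < 1)
    (h1 : (1 - τ) + (1 / q - 1 / p) * (τ + d + (1 - τ) * d) = s)
    (h2 : (2 * τ - 1) + (1 / q - 1 / p') * (τ + d + (1 - τ) * d) = s)
    (h3 : -κ + (1 / q - 1 / p) * κ * (1 - d) + 1 = α)
    (h4 : 2 * κ + (1 / q - 1 / p') * κ * (1 - d) = α) :
    ∃ C : NNReal, ∀ (f : Phase d → ℝ) (G S : Phase d → Sp d),
      MemLp f 2 volume → MemLp G (ENNReal.ofReal p) volume → IsWeakGradV f G →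
      MemLp S (ENNReal.ofReal p') volume → TransportEqDivV f S →
      besovX s (ENNReal.ofReal q) f ≤ C * eLpNorm G (ENNReal.ofReal p) volume ^ α *
        eLpNorm S (ENNReal.ofReal p') volume ^ (1 - α) := by
  obtain ⟨C, hC⟩ := exists_eLpNorm_diffX_le hp hp' hpq hpq' hτ hτ' hs h1 h2 h3 h4
  refine ⟨C, fun f G S hf hG hgrad hS heq => iSup₂_le fun h hh => ?_⟩
  have one_le : ∀ {r : ℝ}, 1 < r → 1 ≤ ENNReal.ofReal r := fun hr => by
    rw [← ENNReal.ofReal_one]; exact ENNReal.ofReal_le_ofReal hr.le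
  have hsol : IsSol f G S := ⟨hf.locallyIntegrable one_le_two, hG.locallyIntegrable (one_le hp),
    hS.locallyIntegrable (one_le hp'), hgrad, heq⟩
  obtain ⟨f', hf'm, hf'⟩ := hf.aestronglyMeasurable
  obtain ⟨G', hG'm, hG'⟩ := hG.aestronglyMeasurable
  obtain ⟨S', hS'm, hS'⟩ := hS.aestronglyMeasurable
  set a := (eLpNorm G (ENNReal.ofReal p) volume).toReal with ha
  set b := (eLpNorm S (ENNReal.ofReal p') volume).toReal with hb
  have ha0 : 0 ≤ a := ENNReal.toReal_nonneg
  have hb0 : 0 ≤ b := ENNReal.toReal_nonneg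
  have ea : eLpNorm G (ENNReal.ofReal p) volume = ENNReal.ofReal a :=
    (ENNReal.ofReal_toReal hG.2.ne).symm
  have eb : eLpNorm S (ENNReal.ofReal p') volume = ENNReal.ofReal b :=
    (ENNReal.ofReal_toReal hS.2.ne).symm
  have hy : 0 < ‖h‖ := norm_pos_iff.2 hh
  have key : ∀ ε : ℝ, 0 < ε → eLpNorm (diffX h f) (ENNReal.ofReal q) volume ≤
      C * ENNReal.ofReal (‖h‖ ^ s * ((a + ε) ^ α * (b + ε) ^ (1 - α))) := fun ε hε => by
    rw [eLpNorm_congr_ae (diffX_congr hf' h)]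
    refine hC f' G' S' hf'm.measurable hG'm.measurable hS'm.measurable (hf.ae_eq hf')
      (hsol.congr hf' hG' hS') (a + ε) (b + ε) (by positivity) (by positivity) ?_ ?_ h hh
    · rw [← eLpNorm_congr_ae hG', ea]
      exact ENNReal.ofReal_le_ofReal (by linarith)
    · rw [← eLpNorm_congr_ae hS', eb]
      exact ENNReal.ofReal_le_ofReal (by linarith)
  have hlim : Filter.Tendsto (fun ε : ℝ => (C : ℝ≥0∞) *
      ENNReal.ofReal (‖h‖ ^ s * ((a + ε) ^ α * (b + ε) ^ (1 - α)))) (nhdsWithin 0 (Set.Ioi 0))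
      (nhds (C * ENNReal.ofReal (‖h‖ ^ s * (a ^ α * b ^ (1 - α))))) := by
    have hc : Continuous fun ε : ℝ => ‖h‖ ^ s * ((a + ε) ^ α * (b + ε) ^ (1 - α)) :=
      continuous_const.mul (((continuous_const.add continuous_id).rpow_const
        fun _ => Or.inr hα.le).mul ((continuous_const.add continuous_id).rpow_const
        fun _ => Or.inr (by linarith)))
    have := (hc.tendsto 0).mono_left (nhdsWithin_le_nhds (s := Set.Ioi 0))
    simp only [add_zero] at this
    exact ENNReal.Tendsto.const_mul (ENNReal.tendsto_ofReal this) (Or.inr ENNReal.coe_ne_top)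
  have hfin := ge_of_tendsto hlim (Filter.eventually_of_mem self_mem_nhdsWithin key)
  refine ENNReal.div_le_of_le_mul (hfin.trans (le_of_eq ?_))
  rw [ea, eb, ENNReal.ofReal_rpow_of_nonneg ha0 hα.le,
    ENNReal.ofReal_rpow_of_nonneg hb0 (by linarith), ENNReal.ofReal_mul (by positivity),
    ENNReal.ofReal_mul (by positivity)]
  ring

end Kinetic

theorem theorem1p3 (d : ℕ) (hd : 1 ≤ d) (p p' qbar q s α : ℝ)
    (hp_lower : 2 - 2 / (3 * (d : ℝ) + 2) < p) (hp_upper : p < 2 + 2 / (d : ℝ))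
    (hp' : p' = p / (p - 1))
    (hqbar : qbar = p * ((4 * (d : ℝ) + 2) / ((d : ℝ) * (p + 2))))
    (hq_lower : max p p' < q) (hq_upper : q < qbar)
    (hs : s = (p * (4 * (d : ℝ) + 2) - q * d * (p + 2)) /
      (q * ((d : ℝ) * (p - 2) + 2 * p + 2)))
    (hα : α = (3 * (d : ℝ) + 1) / (4 * d + 2) - ((d : ℝ) - 1) / (4 * d + 2) * s) :
    (0 < s ∧ s < 1 / 3) ∧
    α = (q * (p * (1 + (d : ℝ)) - d + 1) - ((d : ℝ) - 1) * p) /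
      (q * ((d : ℝ) * (p - 2) + 2 * p + 2)) ∧
    ∃ C : ℝ, 0 < C ∧
      ∀ (f : Kinetic.Phase d → ℝ) (G S₀ : Kinetic.Phase d → Kinetic.Sp d),
        MemLp f 2 volume →
        MemLp G (ENNReal.ofReal p) volume →
        Kinetic.IsWeakGradV f G →
        MemLp S₀ (ENNReal.ofReal p') volume →
        Kinetic.TransportEqDivV f S₀ →
        Kinetic.besovX s (ENNReal.ofReal q) f ≤
          ENNReal.ofReal C * eLpNorm G (ENNReal.ofReal p) volume ^ α *
            eLpNorm S₀ (ENNReal.ofReal p') volume ^ (1 - α) := by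
  have hd1 : (1 : ℝ) ≤ d := by exact_mod_cast hd
  have hd0 : (0 : ℝ) < d := by linarith
  obtain ⟨hpq, hpq'⟩ := max_lt_iff.1 hq_lower
  have hpl : 6 * (d : ℝ) + 2 < p * (3 * d + 2) := by
    have e : 2 - 2 / (3 * (d : ℝ) + 2) = (6 * d + 2) / (3 * d + 2) := by field_simp; ring
    rwa [e, div_lt_iff₀ (by positivity)] at hp_lower
  have hpu : p * d < 2 * d + 2 := by
    have e : 2 + 2 / (d : ℝ) = (2 * d + 2) / d := by field_simp
    rwa [e, lt_div_iff₀ hd0] at hp_upper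
  have hp1 : 1 < p := by nlinarith
  have hp1' : 1 < p' := by rw [hp', lt_div_iff₀ (by linarith)]; linarith
  have hq0 : 0 < q := by linarith
  set D : ℝ := d * (p - 2) + 2 * p + 2 with hD
  have hD0 : 0 < D := by nlinarith
  have hqD : 0 < q * D := mul_pos hq0 hD0
  have hs0 : 0 < s := by
    rw [hqbar, ← mul_div_assoc, lt_div_iff₀ (by positivity)] at hq_upper
    rw [hs]
    exact div_pos (by nlinarith) hqD
  have hs1 : s < 1 / 3 := by
    -- For `p ≥ 2` the bound follows from `p < q`, for `p < 2` from `p' < q`.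
    have key : 3 * p < q * (p + 1) := by
      rcases le_or_gt 2 p with h | h
      · nlinarith
      · rw [hp', div_lt_iff₀ (by linarith)] at hpq'
        nlinarith
    rw [hs, div_lt_div_iff₀ hqD (by norm_num)]
    nlinarith
  have hα0 : 0 < α := by
    have e : α = ((3 * (d : ℝ) + 1) - (d - 1) * s) / (4 * d + 2) := by rw [hα]; field_simp
    rw [e]
    exact div_pos (by nlinarith) (by positivity)
  have hα1 : α < 1 := by
    have e : α = ((3 * (d : ℝ) + 1) - (d - 1) * s) / (4 * d + 2) := by rw [hα]; field_simp
    rw [e, div_lt_one (by positivity)]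
    nlinarith
  have hαq : α = (q * (p * (1 + (d : ℝ)) - d + 1) - ((d : ℝ) - 1) * p) / (q * D) := by
    rw [hα, hs]
    field_simp
    rw [hD]
    ring
  refine ⟨⟨hs0, hs1⟩, hαq, ?_⟩
  have hτ0 : 0 < (2 * p - 4 * d + 2 * d * p) / D := div_pos (by nlinarith) hD0
  have hτ1 : (2 * p - 4 * d + 2 * d * p) / D < 1 := by
    rw [div_lt_one hD0]; nlinarith
  obtain ⟨h1, h2, h3, h4⟩ := Kinetic.scaling_exponents hp1 hq0 hD hD0 rfl rfl hp' hs hαq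
  obtain ⟨C, hC⟩ := Kinetic.exists_besovX_le hp1 hp1' hpq.le hpq'.le hτ0 hτ1 hs0 hα0 hα1
    h1 h2 h3 h4
  -- The constant of the estimate is only known to be nonnegative.
  refine ⟨C + 1, by positivity, fun f G S hf hG hgrad hS heq =>
    (hC f G S hf hG hgrad hS heq).trans ?_⟩
  gcongr
  rw [← ENNReal.ofReal_coe_nnreal]
  exact ENNReal.ofReal_le_ofReal (by linarith)
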